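/- Conventions. For a based space $(Z,z_0)$ let $\mathrm{aut}_1 Z$ be the space of maps $Z\to Z$ that are freely homotopic to the identity, with the compact-open topology, and let $\omega\colon \mathrm{aut}_1 Z\to Z$, $\omega(f)=f(z_0)$, be the evaluation map. For $n\ge 1$ the $n$th Gottlieb group $G_n(Z)\subseteq \pi_n(Z,z_0)$ is the image of $\omega_\#\colon \pi_n(\mathrm{aut}_1 Z,\mathrm{id})\to\pi_n(Z,z_0)$. For based spaces $X$, $Y$ let $\mathrm{map}(X,Y;0)$ be the space of all (unbased) maps $X\to Y$ that are homotopic to the null map (the constant map at the basepoint of $Y$), with the compact-open topology, based at the null map. $\Sigma$ denotes the reduced suspension. A based space is well-pointed if the inclusion of its basepoint is a cofibration. Theorem. Let $X_1,\dots,X_N$ and $Y$ be well-pointed, locally compact Hausdorff spaces, with each $X_i$ connected and $Y$ path-connected. Suppose that each suspension $\Sigma X_i$ is based homotopy equivalent to a finite wedge of spheres $$\Sigma X_i \simeq S^{(i,1)+1}\vee\cdots\vee S^{(i,n_i)+1},$$ where $(i,j)$ are natural numbers (the empty wedge being a point), and let $X=X_1\times\cdots\times X_N$. Then for every $n\ge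 1$ there is an isomorphism of groups $$G_n\big(\mathrm{map}(X,Y;0)\big)\;\cong\; G_n(Y)\;\oplus\;\bigoplus_{r=1}^{N}\ \bigoplus_{\substack{1\le i_1<\cdots<i_r\le N\\ 1\le m_j\le n_{i_j}\ (j=1,\dots,r)}} G_{n+(i_1,m_1)+\cdots+(i_r,m_r)}(Y).$$ -/

import Mathlib

open scoped Topology unitInterval

universe u

/-! ### Based spaces -/

/-- `(X, x₀)` is well-pointed: the inclusion of the basepoint is a cofibration, i.e. it has the
homotopy extension property. The test spaces range over the universe of `X`; as
`WellPointed.exists_extension` shows, this gives the property for test spaces in every universe. -/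
def WellPointed (X : Type u) [TopologicalSpace X] (x₀ : X) : Prop :=
  ∀ (Z : Type u) [TopologicalSpace Z] (f : C(X, Z)) (γ : C(I, Z)), γ 0 = f x₀ →
    ∃ F : C(I × X, Z), (∀ x, F (0, x) = f x) ∧ ∀ t, F (t, x₀) = γ t

/-- For a closed basepoint, the homotopy extension property holds with respect to test spaces in
an arbitrary universe. -/
theorem WellPointed.exists_extension {X : Type u} [TopologicalSpace X] [T1Space X] {x₀ : X}
    (h : WellPointed X x₀) {Z : Type*} [TopologicalSpace Z] (f : C(X, Z)) (γ : C(I, Z))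
    (hγ : γ 0 = f x₀) :
    ∃ F : C(I × X, Z), (∀ x, F (0, x) = f x) ∧ ∀ t, F (t, x₀) = γ t := by
  let A : Set (I × X) := {p | p.1 = 0}
  let B : Set (I × X) := {p | p.2 = x₀}
  have hA : IsClosed A := isClosed_singleton.preimage continuous_fst
  have hB : IsClosed B := isClosed_singleton.preimage continuous_snd
  let M : Type _ := {p : I × X // p ∈ A ∪ B}
  obtain ⟨R, hR0, hR1⟩ := h M ⟨fun x => ⟨(0, x), Or.inl rfl⟩, by fun_prop⟩
    ⟨fun t => ⟨(t, x₀), Or.inr rfl⟩, by fun_prop⟩ rfl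
  classical
  let g : I × X → Z := fun p => if p.1 = 0 then f p.2 else γ p.1
  have hgA : ContinuousOn g A := by
    refine ContinuousOn.congr (f := fun p => f p.2) (by fun_prop) ?_
    intro p hp
    exact if_pos hp
  have hgB : ContinuousOn g B := by
    refine ContinuousOn.congr (f := fun p => γ p.1) (by fun_prop) ?_
    rintro ⟨t, x⟩ hp
    have hx : x = x₀ := hp
    subst hx
    by_cases ht : t = 0
    · subst ht
      simp [g, hγ]
    · simp [g, ht]
  have hg : Continuous fun p : M => g p.1 :=
    (hgA.union_of_isClosed hgB hA hB).domRestrict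
  refine ⟨⟨fun p => g (R p).1, hg.comp R.continuous⟩, fun x => ?_, fun t => ?_⟩
  · have := hR0 x
    simp only [ContinuousMap.coe_mk] at this ⊢
    rw [this]
    simp [g]
  · have := hR1 t
    simp only [ContinuousMap.coe_mk] at this ⊢
    rw [this]
    by_cases ht : t = 0
    · subst ht
      simp [g, hγ]
    · simp [g, ht]

/-- Based homotopy equivalence of the based spaces `(A, a)` and `(B, b)`. -/
def BasedHomotopyEquivalent {A B : Type*} [TopologicalSpace A] [TopologicalSpace B]
    (a : A) (b : B) : Prop :=
  ∃ (f : C(A, B)) (g : C(B, A)), f a = b ∧ g b = a ∧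
    (g.comp f).HomotopicRel (ContinuousMap.id A) {a} ∧
    (f.comp g).HomotopicRel (ContinuousMap.id B) {b}

/-- The relation on `X × I` collapsing `X × {0, 1} ∪ {x₀} × I` to a point. -/
def SuspRel {X : Type*} (x₀ : X) (p q : X × I) : Prop :=
  (p.2 = 0 ∨ p.2 = 1 ∨ p.1 = x₀) ∧ (q.2 = 0 ∨ q.2 = 1 ∨ q.1 = x₀)

/-- The reduced suspension `ΣX` of `(X, x₀)`, with the quotient topology. -/
abbrev ReducedSuspension {X : Type*} [TopologicalSpace X] (x₀ : X) : Type _ :=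
  Quot (SuspRel x₀)

/-- The basepoint of `ΣX`. -/
def ReducedSuspension.base {X : Type*} [TopologicalSpace X] (x₀ : X) : ReducedSuspension x₀ :=
  Quot.mk _ (x₀, 0)

/-- The relation gluing all basepoints `b j` to one additional point. -/
inductive WedgeRel {J : Type*} {S : J → Type*} (b : ∀ j, S j) :
    Unit ⊕ (Σ j, S j) → Unit ⊕ (Σ j, S j) → Prop
  | glue (j : J) : WedgeRel b (Sum.inl ()) (Sum.inr ⟨j, b j⟩)

/-- The wedge `⋁ j, S j` of based spaces, with the quotient topology. The extra point makes the
empty wedge a one-point space. -/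
abbrev Wedge {J : Type*} {S : J → Type*} [∀ j, TopologicalSpace (S j)] (b : ∀ j, S j) : Type _ :=
  Quot (WedgeRel b)

/-- The basepoint of the wedge. -/
def Wedge.base {J : Type*} {S : J → Type*} [∀ j, TopologicalSpace (S j)] (b : ∀ j, S j) :
    Wedge b :=
  Quot.mk _ (Sum.inl ())

/-- The `m`-sphere, the unit sphere of `ℝᵐ⁺¹`. -/
abbrev Sphere (m : ℕ) : Type := Metric.sphere (0 : EuclideanSpace ℝ (Fin (m + 1))) 1

/-- The basepoint `(1, 0, …, 0)` of the `m`-sphere. -/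
noncomputable def Sphere.base (m : ℕ) : Sphere m :=
  ⟨EuclideanSpace.single 0 1, by simp⟩

/-! ### Homotopy groups and Gottlieb groups -/

/-- Composition of a based map with an `N`-dimensional loop. -/
def GenLoop.postcomp {N X Y : Type*} [TopologicalSpace X] [TopologicalSpace Y] {x : X} {y : Y}
    (f : C(X, Y)) (hf : f x = y) (p : GenLoop N X x) : GenLoop N Y y :=
  ⟨f.comp p.1, fun t ht => by
    rw [ContinuousMap.comp_apply, show p.1 t = x from p.2 t ht, hf]⟩

/-- The homomorphism `f_# : π_n(X, x) → π_n(Y, y)` induced by a based map `f`. -/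
noncomputable def inducedHom (n : ℕ) [NeZero n] {X Y : Type*} [TopologicalSpace X]
    [TopologicalSpace Y] {x : X} {y : Y} (f : C(X, Y)) (hf : f x = y) :
    HomotopyGroup.Pi n X x →* HomotopyGroup.Pi n Y y :=
  MonoidHom.mk'
    (Quotient.map (GenLoop.postcomp f hf)
      (fun _ _ h => ContinuousMap.HomotopicRel.comp_continuousMap h f))
    (by
      rintro ⟨p⟩ ⟨q⟩
      have h1 := HomotopyGroup.mul_spec (N := Fin n) (x := x) (i := (0 : Fin n)) (p := p) (q := q)
      have h2 := HomotopyGroup.mul_spec (N := Fin n) (x := y) (i := (0 : Fin n))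
        (p := GenLoop.postcomp f hf p) (q := GenLoop.postcomp f hf q)
      refine (congrArg _ h1).trans (Eq.trans ?_ h2.symm)
      refine congrArg (Quotient.mk _) (GenLoop.ext _ _ fun t => ?_)
      simp only [GenLoop.transAt, GenLoop.coe_copy]
      change f (ite _ _ _) = _
      split_ifs <;> rfl)

/-- `aut₁ Y`: the space of self-maps of `Y` that are freely homotopic to the identity (in
particular they are homotopy equivalences), with the compact-open topology. -/
abbrev AutOne (Y : Type*) [TopologicalSpace Y] : Type _ :=
  {f : C(Y, Y) // f.Homotopic (ContinuousMap.id Y)}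

/-- The identity, the basepoint of `aut₁ Y`. -/
def AutOne.one (Y : Type*) [TopologicalSpace Y] : AutOne Y :=
  ⟨ContinuousMap.id Y, ContinuousMap.Homotopic.refl _⟩

/-- The evaluation map `ω : aut₁ Y → Y`, `ω(f) = f(y₀)`. -/
def AutOne.eval {Y : Type*} [TopologicalSpace Y] (y₀ : Y) : C(AutOne Y, Y) :=
  ⟨fun f => f.1 y₀, (continuous_eval_const y₀).comp continuous_subtype_val⟩

/-- The `n`-th Gottlieb group `G_n(Y) ⊆ π_n(Y, y₀)` for `n ≥ 1`: the image of
`ω_# : π_n(aut₁ Y, id) → π_n(Y, y₀)`. -/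
noncomputable def gottliebGroup (n : ℕ) [NeZero n] (Y : Type*) [TopologicalSpace Y] (y₀ : Y) :
    Subgroup (HomotopyGroup.Pi n Y y₀) :=
  (inducedHom n (AutOne.eval y₀) (show AutOne.eval y₀ (AutOne.one Y) = y₀ from rfl)).range

/-- `map(X, Y; 0)`: the component of the null map `X → {y₀} ⊆ Y` in the space of all (unbased)
maps from `X` to `Y` with the compact-open topology. -/
abbrev NullComponent (X Y : Type*) [TopologicalSpace X] [TopologicalSpace Y] (y₀ : Y) : Type _ :=
  {f : C(X, Y) // f.Homotopic (ContinuousMap.const X y₀)}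

/-- The null map, the basepoint of `map(X, Y; 0)`. -/
def NullComponent.null (X : Type*) {Y : Type*} [TopologicalSpace X] [TopologicalSpace Y] (y₀ : Y) :
    NullComponent X Y y₀ :=
  ⟨ContinuousMap.const X y₀, ContinuousMap.Homotopic.refl _⟩

/-! ### The index set of the decomposition -/

/-- The choices of `1 ≤ r ≤ N`, of indices `i₁ < ⋯ < i_r` among the `N` indices, and of one of the
`k (i_j)` elements `m_j` for each `j`. -/
structure SphereChoice {N : ℕ} (k : Fin N → ℕ) where
  /-- the number of chosen indices -/
  r : ℕ
  one_le_r : 1 ≤ r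
  r_le : r ≤ N
  /-- the chosen indices -/
  i : Fin r → Fin N
  strictMono_i : StrictMono i
  /-- the chosen spheres -/
  m : ∀ j : Fin r, Fin (k (i j))

/-- A degree stays positive when a natural number is added. -/
instance instNeZeroNatAdd (n m : ℕ) [NeZero n] : NeZero (n + m) :=
  ⟨by have := NeZero.ne n; omega⟩

/-! ### Relative homotopies and based homotopy classes -/

section RelativeHomotopies

variable {A B W W' : Type*} [TopologicalSpace A] [TopologicalSpace B] [TopologicalSpace W]
  [TopologicalSpace W']

/-! Let ω : map(Y,Y) → Y be evaluation at the basepoint. A cube of self-maps that is the identity on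
the boundary stays in the component of the identity, so G_n(Y) is the image of ω_# on π_n(map(Y,Y)).
A loop Φ_t of self-maps of map(X,Y;0), applied to constant maps, gives the loop x ↦ (y' ↦ Φ_t(const
y')(x)) in map(X, map(Y,Y)); conversely, a loop A_t there acts by f ↦ (x ↦ A_t(x)(f(x))). Hence
G_n(map(X,Y;0)) is the image of π_n(map(X, map(Y,Y))) → π_n(map(X,Y)) induced by ω
(`NullComponent.map_gottliebGroup`).

For a single factor X, evaluation at x₀ on π_n(map(X,Z)) is split by the constants and has kernel
[ΣX, Ω^{n-1}Z]. The wedge decomposition then gives a bijection π_n(Z) × ∏ π_{n+d_j}(Z) ≃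
π_n(map(X,Z)), natural in Z (`splitLoop_bijective`, `mapGroupEquiv_mapOf`). A priori it is only a
bijection of sets. If Z = H carries a strictly unital multiplication, such as map(Y,Y) under
composition, Eckmann–Hilton expresses every group operation through that multiplication, and
naturality makes the bijection a homomorphism. The images in the groups of Y inherit their
operations from H, so the isomorphism passes to them (`nonempty_range_mulEquiv`,
`inducedRange_postcompMap`).

Products follow by induction from map(X₀ × X', Z) = map(X₀, map(X', Z)), since map(X',H) is again
unital under pointwise multiplication. The summands are indexed by a choice of at most one sphere
per factor; the empty choice is G_n(Y) and the others form `SphereChoice`. -/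

theorem ContinuousMap.homotopicRel_iff_exists_path {f g : C(B, W)} {S : Set B} :
    f.HomotopicRel g S ↔ ∃ G : C(B, C(I, W)), (∀ x, G x 0 = f x) ∧ (∀ x, G x 1 = g x) ∧
      ∀ x ∈ S, G x = ContinuousMap.const I (f x) := by
  constructor
  · rintro ⟨F⟩
    refine ⟨(F.toContinuousMap.comp ⟨Prod.swap, continuous_swap⟩).curry, fun x => F.apply_zero x,
      fun x => F.apply_one x, fun x hx => ContinuousMap.ext fun t => F.eq_fst t hx⟩
  · rintro ⟨G, h0, h1, hS⟩
    exact ⟨⟨⟨G.uncurry.comp ⟨Prod.swap, continuous_swap⟩, h0, h1⟩,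
      fun t x hx => congrArg (fun p : C(I, W) => p t) (hS x hx)⟩⟩

theorem ContinuousMap.HomotopicRel.precomp {f g : C(B, W)} {S : Set A} {T : Set B}
    (h : f.HomotopicRel g T) (q : C(A, B)) (hq : Set.MapsTo q S T) :
    (f.comp q).HomotopicRel (g.comp q) S := by
  rw [ContinuousMap.homotopicRel_iff_exists_path] at h ⊢
  obtain ⟨G, h0, h1, hS⟩ := h
  exact ⟨G.comp q, fun x => h0 _, fun x => h1 _, fun x hx => hS _ (hq hx)⟩

/-- Based homotopy of based maps. -/
def BasedClasses.setoid (b : B) (w : W) : Setoid {f : C(B, W) // f b = w} where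
  r f g := f.1.HomotopicRel g.1 {b}
  iseqv := ⟨fun _ => .refl _, fun h => h.symm, fun h h' => h.trans h'⟩

/-- The set of based homotopy classes of based maps `(B, b) → (W, w)`. -/
def BasedClasses (b : B) (w : W) : Type _ :=
  Quotient (BasedClasses.setoid b w)

namespace BasedClasses

variable {a : A} {b : B} {w : W} {w' : W'}

/-- The class of a based map. -/
def mk (f : C(B, W)) (hf : f b = w) : BasedClasses b w :=
  Quotient.mk (setoid b w) ⟨f, hf⟩

theorem mk_surjective (z : BasedClasses b w) : ∃ f hf, z = mk f hf := by
  obtain ⟨⟨f, hf⟩, rfl⟩ := Quotient.exists_rep z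
  exact ⟨f, hf, rfl⟩

theorem mk_eq_mk {f g : C(B, W)} {hf : f b = w} {hg : g b = w} :
    mk f hf = mk g hg ↔ f.HomotopicRel g {b} :=
  Quotient.eq (r := setoid b w)

/-- Postcomposition with a based map. -/
def map (b : B) (f : C(W, W')) (hf : f w = w') : BasedClasses b w → BasedClasses b w' :=
  Quotient.map (sa := setoid b w) (sb := setoid b w')
    (fun g => ⟨f.comp g.1, by rw [ContinuousMap.comp_apply, g.2, hf]⟩)
    (fun _ _ h => ContinuousMap.HomotopicRel.comp_continuousMap h f)

/-- Precomposition with a based map. -/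
def precomp (q : C(A, B)) (hq : q a = b) (w : W) : BasedClasses b w → BasedClasses a w :=
  Quotient.map (sa := setoid b w) (sb := setoid a w)
    (fun g => ⟨g.1.comp q, by rw [ContinuousMap.comp_apply, hq, g.2]⟩)
    (fun _ _ h => ContinuousMap.HomotopicRel.precomp h q (by simp [hq, Set.MapsTo]))

theorem precomp_map (q : C(A, B)) (hq : q a = b) (f : C(W, W')) (hf : f w = w')
    (z : BasedClasses b w) :
    precomp q hq w' (map b f hf z) = map a f hf (precomp q hq w z) := by
  obtain ⟨g, hg, rfl⟩ := mk_surjective z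
  rfl

theorem precomp_bijective {q : C(A, B)} (hq : q a = b) {r : C(B, A)} (hr : r b = a)
    (hrq : (r.comp q).HomotopicRel (ContinuousMap.id A) {a})
    (hqr : (q.comp r).HomotopicRel (ContinuousMap.id B) {b}) (w : W) :
    Function.Bijective (precomp q hq w) := by
  rw [Function.bijective_iff_has_inverse]
  refine ⟨precomp r hr w, fun z => ?_, fun z => ?_⟩
  · obtain ⟨g, hg, rfl⟩ := mk_surjective z
    exact mk_eq_mk.2 (hqr.comp_continuousMap g)
  · obtain ⟨g, hg, rfl⟩ := mk_surjective z
    exact mk_eq_mk.2 (hrq.comp_continuousMap g)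

end BasedClasses

/-- `q` exhibits `(B, b)` as the quotient of `K` obtained by collapsing `L` to the point `b`. -/
structure IsCollapse {K : Type*} [TopologicalSpace K] (q : C(K, B)) (L : Set K) (b : B) :
    Prop where
  isQuotientMap : Topology.IsQuotientMap q
  nonempty : L.Nonempty
  map_eq : ∀ k ∈ L, q k = b
  eq_or_mem : ∀ k k', q k = q k' → k = k' ∨ k ∈ L ∧ k' ∈ L

namespace IsCollapse

variable {K : Type*} [TopologicalSpace K] {q : C(K, B)} {L : Set K} {b : B} {w : W}

theorem exists_lift (h : IsCollapse q L b) (p : C(K, W)) (hp : ∀ k ∈ L, p k = w) :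
    ∃ f : C(B, W), f b = w ∧ f.comp q = p := by
  have hpq : Function.FactorsThrough p q := by
    intro k k' hk
    obtain rfl | ⟨h1, h2⟩ := h.eq_or_mem k k' hk
    · rfl
    · rw [hp _ h1, hp _ h2]
  refine ⟨h.isQuotientMap.lift p hpq, ?_, h.isQuotientMap.lift_comp p hpq⟩
  obtain ⟨k, hk⟩ := h.nonempty
  exact (congrArg _ (h.map_eq k hk)).symm.trans
    ((DFunLike.congr_fun (h.isQuotientMap.lift_comp p hpq) k).trans (hp k hk))

/-- A homotopy is treated as a map into the path space C(I, W), so it descends by the universal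
property of `q` alone; one need not know that q × id_I is a quotient map. -/
theorem homotopicRel_iff (h : IsCollapse q L b) {f g : C(B, W)} (hf : f b = w) :
    f.HomotopicRel g {b} ↔ (f.comp q).HomotopicRel (g.comp q) L := by
  refine ⟨fun H => H.precomp q fun k hk => h.map_eq k hk, fun H => ?_⟩
  rw [ContinuousMap.homotopicRel_iff_exists_path] at H ⊢
  obtain ⟨G, h0, h1, hS⟩ := H
  obtain ⟨G', hG', hG⟩ := h.exists_lift (w := ContinuousMap.const I w) G (fun k hk => by
    rw [hS k hk, ContinuousMap.comp_apply, h.map_eq k hk, hf])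
  refine ⟨G', fun x => ?_, fun x => ?_, fun x hx => ?_⟩
  · obtain ⟨k, rfl⟩ := h.isQuotientMap.surjective x
    rw [← ContinuousMap.comp_apply, hG, h0, ContinuousMap.comp_apply]
  · obtain ⟨k, rfl⟩ := h.isQuotientMap.surjective x
    rw [← ContinuousMap.comp_apply, hG, h1, ContinuousMap.comp_apply]
  · rw [Set.mem_singleton_iff.1 hx, hG', hf]

end IsCollapse

/-- The homomorphism of homotopy groups, as a map of sets, for an arbitrary type of coordinates. -/
def HomotopyGroup.mapOf (N : Type*) {w : W} {w' : W'} (f : C(W, W')) (hf : f w = w') :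
    HomotopyGroup N W w → HomotopyGroup N W' w' :=
  Quotient.map (GenLoop.postcomp f hf)
    (fun _ _ h => ContinuousMap.HomotopicRel.comp_continuousMap h f)

/-- A map exhibiting `(B, b)` as a cube modulo its boundary identifies based homotopy classes
with elements of a homotopy group. -/
def BasedClasses.toHomotopyGroup {N : Type*} {b : B} {q : C(N → I, B)}
    (h : IsCollapse q (Cube.boundary N) b) (w : W) : BasedClasses b w → HomotopyGroup N W w :=
  Quotient.map (sa := setoid b w) (sb := GenLoop.Homotopic.setoid N w)
    (fun f => ⟨f.1.comp q, fun k hk => by rw [ContinuousMap.comp_apply, h.map_eq k hk, f.2]⟩)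
    (fun f _ H => (h.homotopicRel_iff f.2).1 H)

theorem BasedClasses.toHomotopyGroup_bijective {N : Type*} {b : B} {q : C(N → I, B)}
    (h : IsCollapse q (Cube.boundary N) b) (w : W) :
    Function.Bijective (toHomotopyGroup h w) := by
  constructor
  · intro z z' hz
    obtain ⟨f, hf, rfl⟩ := mk_surjective z
    obtain ⟨g, hg, rfl⟩ := mk_surjective z'
    exact mk_eq_mk.2 ((h.homotopicRel_iff hf).2
      (Quotient.exact (s := GenLoop.Homotopic.setoid N w) hz))
  · rintro ⟨p, hp⟩
    obtain ⟨f, hf, hfp⟩ := h.exists_lift p hp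
    refine ⟨mk f hf, ?_⟩
    subst hfp
    rfl

end RelativeHomotopies

/-! ### Wedges -/

section Wedges

variable {J : Type*} {S : J → Type*} [∀ j, TopologicalSpace (S j)] (b : ∀ j, S j)
  {W W' : Type*} [TopologicalSpace W] [TopologicalSpace W']

/-- The inclusion of a summand into a wedge. -/
def Wedge.incl (j : J) : C(S j, Wedge b) :=
  ⟨fun s => Quot.mk _ (Sum.inr ⟨j, s⟩), by
    exact continuous_quot_mk.comp (continuous_inr.comp continuous_sigmaMk)⟩

theorem Wedge.incl_base (j : J) : Wedge.incl b j (b j) = Wedge.base b :=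
  (Quot.sound (WedgeRel.glue j)).symm

variable {b} in
theorem Wedge.exists_desc {w : W} (g : ∀ j, C(S j, W)) (hg : ∀ j, g j (b j) = w) :
    ∃ f : C(Wedge b, W), f (Wedge.base b) = w ∧ ∀ j, f.comp (Wedge.incl b j) = g j := by
  refine ⟨⟨Quot.lift (Sum.elim (fun _ => w) fun s => g s.1 s.2) ?_, ?_⟩, rfl, fun j => rfl⟩
  · rintro _ _ ⟨j⟩
    exact (hg j).symm
  · exact continuous_quot_lift _ (continuous_const.sumElim (continuous_sigma fun j =>
      (g j).continuous))

variable {b} in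
theorem Wedge.induction {P : Wedge b → Prop} (h0 : P (Wedge.base b))
    (h : ∀ j s, P (Wedge.incl b j s)) (z : Wedge b) : P z := by
  obtain ⟨⟨⟩ | ⟨j, s⟩⟩ := z
  · exact h0
  · exact h j s

/-- Restriction of based homotopy classes on a wedge to the summands. -/
def BasedClasses.restrictWedge (w : W) (z : BasedClasses (Wedge.base b) w) (j : J) :
    BasedClasses (b j) w :=
  precomp (Wedge.incl b j) (Wedge.incl_base b j) w z

/-- Both maps and homotopies, the latter as maps into C(I, W), glue along the basepoint, where the
homotopies are constant. -/
theorem BasedClasses.restrictWedge_bijective (w : W) :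
    Function.Bijective (restrictWedge b w) := by
  constructor
  · intro z z' hz
    obtain ⟨f, hf, rfl⟩ := mk_surjective z
    obtain ⟨g, hg, rfl⟩ := mk_surjective z'
    have H : ∀ j, (f.comp (Wedge.incl b j)).HomotopicRel (g.comp (Wedge.incl b j)) {b j} :=
      fun j => mk_eq_mk.1 (congrFun hz j)
    simp only [ContinuousMap.homotopicRel_iff_exists_path] at H
    choose G h0 h1 hS using H
    obtain ⟨G', hG', hG⟩ := Wedge.exists_desc (b := b) (w := ContinuousMap.const I w) G
      (fun j => by
        rw [hS j _ rfl, ContinuousMap.comp_apply, Wedge.incl_base, hf])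
    have hG'' : ∀ j s, G' (Wedge.incl b j s) = G j s := fun j s => by rw [← hG]; rfl
    refine mk_eq_mk.2 (ContinuousMap.homotopicRel_iff_exists_path.2 ⟨G', ?_, ?_, ?_⟩)
    · refine Wedge.induction ?_ fun j s => ?_
      · rw [hG', hf]; rfl
      · rw [hG'', h0]; rfl
    · refine Wedge.induction ?_ fun j s => ?_
      · rw [hG', hg]; rfl
      · rw [hG'', h1]; rfl
    · rintro _ rfl
      rw [hG', hf]
  · intro z
    choose g hg hz using fun j => mk_surjective (z j)
    obtain ⟨f, hf, hfg⟩ := Wedge.exists_desc (b := b) g hg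
    refine ⟨mk f hf, funext fun j => ?_⟩
    rw [hz j]
    simp only [← hfg]
    rfl

end Wedges

/-! ### The sphere as a quotient of the cube -/

section CubeSphere

open Topology

/-- Collapsing the complement of an open subspace to the point at infinity. -/
theorem OnePoint.exists_collapse {U K : Type*} [TopologicalSpace U] [TopologicalSpace K]
    [T2Space K] {φ : U → K} (hφ : IsOpenEmbedding φ) :
    ∃ c : C(K, OnePoint U), (∀ u, c (φ u) = u) ∧ ∀ k ∉ Set.range φ, c k = OnePoint.infty := by
  classical
  let c : K → OnePoint U := fun k => if h : k ∈ Set.range φ then (h.choose : OnePoint U) else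
    OnePoint.infty
  have hc : ∀ u, c (φ u) = u := by
    intro u
    have h : φ u ∈ Set.range φ := ⟨u, rfl⟩
    have h' : c (φ u) = (h.choose : OnePoint U) := dif_pos h
    rw [h', hφ.injective h.choose_spec]
  have hc' : ∀ k ∉ Set.range φ, c k = OnePoint.infty := fun k hk => dif_neg hk
  refine ⟨⟨c, continuous_def.2 fun s hs => ?_⟩, hc, hc'⟩
  have hs' := OnePoint.isOpen_def.1 hs
  by_cases hmem : OnePoint.infty ∈ s
  -- A neighbourhood of ∞ pulls back to the complement of the image of a compact set, which is
  -- closed because K is Hausdorff.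
  · have : c ⁻¹' s = (φ '' ((↑) ⁻¹' s : Set U)ᶜ)ᶜ := by
      ext k
      by_cases hk : k ∈ Set.range φ
      · obtain ⟨u, rfl⟩ := hk
        simp [hc, hφ.injective.eq_iff]
      · have : ∀ u, φ u ≠ k := fun u hu => hk ⟨u, hu⟩
        simp [hc' k hk, hmem, this]
    rw [this]
    exact ((hs'.1 hmem).image hφ.continuous).isClosed.isOpen_compl
  · have : c ⁻¹' s = φ '' ((↑) ⁻¹' s : Set U) := by
      ext k
      by_cases hk : k ∈ Set.range φ
      · obtain ⟨u, rfl⟩ := hk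
        simp [hc, hφ.injective.eq_iff]
      · have : ∀ u, φ u ≠ k := fun u hu => hk ⟨u, hu⟩
        simp [hc' k hk, hmem, this]
    rw [this]
    exact hφ.isOpenMap _ hs'.2

/-- The coordinatewise sigmoid identifies ℝᵐ with the interior of the cube, so collapsing the
boundary gives the one-point compactification of ℝᵐ. -/
theorem Cube.isOpenEmbedding_sigmoid (m : ℕ) :
    IsOpenEmbedding (fun (v : Fin m → ℝ) i => unitInterval.sigmoid (v i)) ∧
      Set.range (fun (v : Fin m → ℝ) i => unitInterval.sigmoid (v i)) =
        (Cube.boundary (Fin m))ᶜ := by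
  have hs : IsOpenEmbedding unitInterval.sigmoid :=
    ⟨isEmbedding_sigmoid, by rw [unitInterval.range_sigmoid]; exact isOpen_Ioo⟩
  refine ⟨IsOpenEmbedding.piMap fun _ => hs, Set.ext fun t => ⟨?_, fun ht => ?_⟩⟩
  · rintro ⟨v, rfl⟩ ⟨i, hi | hi⟩
    · exact (unitInterval.sigmoid_pos (v i)).ne' hi
    · exact (unitInterval.sigmoid_lt_one (v i)).ne hi
  · have : ∀ i, t i ∈ Set.range unitInterval.sigmoid := fun i => by
      rw [unitInterval.range_sigmoid]
      exact ⟨unitInterval.pos_iff_ne_zero.2 fun h => ht ⟨i, Or.inl h⟩,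
        unitInterval.lt_one_iff_ne_one.2 fun h => ht ⟨i, Or.inr h⟩⟩
    choose v hv using this
    exact ⟨v, funext hv⟩

/-- Stereographic projection from the basepoint v, with ℝᵐ identified linearly with the hyperplane
orthogonal to v. -/
theorem Sphere.exists_homeomorph_onePoint (m : ℕ) :
    ∃ e : OnePoint (Fin m → ℝ) ≃ₜ Sphere m, e OnePoint.infty = Sphere.base m := by
  let v : EuclideanSpace ℝ (Fin (m + 1)) := EuclideanSpace.single 0 1
  have hv : ‖v‖ = 1 := by simp [v]
  have hv0 : v ≠ 0 := fun h => by simp [h] at hv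
  have : Fact (Module.finrank ℝ (EuclideanSpace ℝ (Fin (m + 1))) = m + 1) := ⟨by simp⟩
  have hV : Module.finrank ℝ (Fin m → ℝ) = Module.finrank ℝ (Submodule.span ℝ {v})ᗮ := by
    rw [Submodule.finrank_orthogonal_span_singleton (n := m) hv0]
    simp
  let e : (Fin m → ℝ) ≃ₜ (Submodule.span ℝ {v})ᗮ :=
    (FiniteDimensional.nonempty_continuousLinearEquiv_of_finrank_eq hV).some.toHomeomorph
  exact ⟨e.onePointCongr.trans (onePointHyperplaneHomeoUnitSphere hv), rfl⟩

/-- The `m`-sphere is the `m`-cube with its boundary collapsed to the basepoint. -/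
theorem Sphere.exists_isCollapse (m : ℕ) [NeZero m] :
    ∃ q : C(Fin m → I, Sphere m), IsCollapse q (Cube.boundary (Fin m)) (Sphere.base m) := by
  obtain ⟨hφ, hr⟩ := Cube.isOpenEmbedding_sigmoid m
  obtain ⟨c, hc, hc'⟩ := OnePoint.exists_collapse hφ
  obtain ⟨e, he⟩ := Sphere.exists_homeomorph_onePoint m
  rw [hr] at hc'
  have hc'' : ∀ k ∈ Cube.boundary (Fin m), c k = OnePoint.infty :=
    fun k hk => hc' k (by simpa using hk)
  have hne : (Cube.boundary (Fin m)).Nonempty := ⟨0, 0, Or.inl rfl⟩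
  have hint : ∀ k ∉ Cube.boundary (Fin m), ∃ u : Fin m → ℝ, k = fun i => unitInterval.sigmoid (u i) := by
    intro k hk
    have : k ∈ (Cube.boundary (Fin m))ᶜ := hk
    rw [← hr] at this
    obtain ⟨u, rfl⟩ := this
    exact ⟨u, rfl⟩
  have hsurj : Function.Surjective c := by
    intro z
    induction z using OnePoint.rec with
    | infty => exact ⟨hne.some, hc'' _ hne.some_mem⟩
    | coe u => exact ⟨_, hc u⟩
  refine ⟨(e : C(_, _)).comp c, ?_, hne, fun k hk => ?_, fun k k' h => ?_⟩
  -- A continuous surjection from a compact space to a Hausdorff space is a quotient map.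
  · exact IsQuotientMap.of_surjective_continuous (e.surjective.comp hsurj)
      (e.continuous.comp c.continuous)
  · simp [hc'' k hk, he]
  · replace h : c k = c k' := e.injective h
    by_cases hk : k ∈ Cube.boundary (Fin m) <;> by_cases hk' : k' ∈ Cube.boundary (Fin m)
    · exact Or.inr ⟨hk, hk'⟩
    · obtain ⟨u, rfl⟩ := hint k' hk'
      rw [hc'' k hk, hc u] at h
      exact absurd h (OnePoint.infty_ne_coe u)
    · obtain ⟨u, rfl⟩ := hint k hk
      rw [hc'' k' hk', hc u] at h
      exact absurd h (OnePoint.coe_ne_infty u)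
    · obtain ⟨u, rfl⟩ := hint k hk
      obtain ⟨u', rfl⟩ := hint k' hk'
      rw [hc u, hc u', OnePoint.coe_eq_coe] at h
      exact Or.inl (by rw [h])

end CubeSphere

/-! ### Families of loops and the reduced suspension -/

section LoopFamilies

variable {X : Type u} {W W' : Type*} [TopologicalSpace X] [TopologicalSpace W]
  [TopologicalSpace W'] {w : W} {w' : W'}

/-- A family of loops in `W`, as a loop in the mapping space. -/
def pathOfFamily (g : C(X, Path w w)) :
    Path (ContinuousMap.const X w) (ContinuousMap.const X w) where
  toFun t := ⟨fun x => g x t, by fun_prop⟩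
  continuous_toFun := ContinuousMap.continuous_of_continuous_uncurry _ (by
    change Continuous fun p : I × X => g p.2 p.1
    fun_prop)
  source' := by ext x; exact (g x).source
  target' := by ext x; exact (g x).target

/-- A loop in the mapping space, as a family of loops. -/
def familyOfPath [LocallyCompactSpace X]
    (p : Path (ContinuousMap.const X w) (ContinuousMap.const X w)) : C(X, Path w w) where
  toFun x := ⟨⟨fun t => p t x, by fun_prop⟩,
    congrArg (fun f : C(X, W) => f x) p.source, congrArg (fun f : C(X, W) => f x) p.target⟩
  continuous_toFun := Path.continuous_uncurry_iff.1 (by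
    change Continuous fun q : X × I => p q.2 q.1
    fun_prop)

/-- Both homotopies are the same function of three variables, in I × I × X; local compactness makes
evaluation on C(X, W) jointly continuous. -/
theorem pathOfFamily_homotopic_iff [LocallyCompactSpace X] {g g' : C(X, Path w w)} :
    (pathOfFamily g).Homotopic (pathOfFamily g') ↔ g.Homotopic g' := by
  constructor
  · rintro ⟨F⟩
    have hF : ∀ (s : I) (x : X), F (s, 0) x = w ∧ F (s, 1) x = w := fun s x =>
      ⟨congrArg (fun f : C(X, W) => f x) (F.source s),
        congrArg (fun f : C(X, W) => f x) (F.target s)⟩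
    refine ⟨⟨⟨fun q => ⟨⟨fun t => F (q.1, t) q.2, by fun_prop⟩, (hF _ _).1, (hF _ _).2⟩,
      Path.continuous_uncurry_iff.1 ?_⟩, fun x => ?_, fun x => ?_⟩⟩
    · change Continuous fun r : (I × X) × I => F (r.1.1, r.2) r.1.2
      fun_prop
    · ext t
      exact congrArg (fun f : C(X, W) => f x) (F.apply_zero t)
    · ext t
      exact congrArg (fun f : C(X, W) => f x) (F.apply_one t)
  · rintro ⟨K⟩
    refine ⟨⟨⟨⟨fun q => ⟨fun x => K (q.1, x) q.2, by fun_prop⟩,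
      ContinuousMap.continuous_of_continuous_uncurry _ ?_⟩, fun t => ?_, fun t => ?_⟩,
      fun s t ht => ?_⟩⟩
    · change Continuous fun r : (I × I) × X => K (r.1.1, r.2) r.1.2
      fun_prop
    · ext x
      exact congrArg (fun p : Path w w => p t) (K.apply_zero x)
    · ext x
      exact congrArg (fun p : Path w w => p t) (K.apply_one x)
    · ext x
      rcases ht with rfl | rfl
      · exact (K (s, x)).source.trans (g x).source.symm
      · exact (K (s, x)).target.trans (g x).target.symm

/-- The usual reparametrization shrinking the trailing constant path is jointly continuous in the
loop, and it fixes the constant loop, so the homotopy is relative to x₀. -/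
theorem homotopicRel_trans_refl {x₀ : X} {g : C(X, Path w w)} (hg : g x₀ = Path.refl w)
    (g' : C(X, Path w w)) (h : ∀ x, g' x = (g x).trans (Path.refl w)) :
    g'.HomotopicRel g {x₀} := by
  have key : Continuous fun r : (I × X) × I => Path.Homotopy.transRefl (g r.1.2) (r.1.1, r.2) := by
    change Continuous fun r : (I × X) × I => g r.1.2
      ⟨unitInterval.symm (unitInterval.symm r.1.1) * r.2 +
        unitInterval.symm r.1.1 * Path.Homotopy.transReflReparamAux r.2, _⟩
    fun_prop
  refine ⟨⟨⟨⟨fun q => (Path.Homotopy.transRefl (g q.2)).eval q.1,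
    Path.continuous_uncurry_iff.1 key⟩, fun x => ?_, fun x => ?_⟩, fun s x hx => ?_⟩⟩
  · exact (Path.Homotopy.eval_zero _).trans (h x).symm
  · exact Path.Homotopy.eval_one _
  · obtain rfl := Set.mem_singleton_iff.1 hx
    change (Path.Homotopy.transRefl (g x)).eval s = g' x
    rw [h, hg]
    ext t
    exact (congrArg (fun p : Path w w => p t) (Path.refl_trans_refl (a := w))).symm

/-- A family of loops that is null at the basepoint is homotopic to a based family. -/
theorem WellPointed.exists_based_family [T1Space X] {x₀ : X} (hX : WellPointed X x₀)
    (g : C(X, Path w w)) (hg : (g x₀).Homotopic (Path.refl w)) :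
    ∃ g' : C(X, Path w w), g' x₀ = Path.refl w ∧ g.Homotopic g' := by
  obtain ⟨H⟩ := hg
  -- The null-homotopy of g(x₀) is a path in the loop space of W, and the homotopy extension
  -- property spreads it over X.
  obtain ⟨F, hF0, hF1⟩ := hX.exists_extension g
    ⟨fun s => H.eval s, Path.continuous_uncurry_iff.1 H.continuous⟩ (Path.Homotopy.eval_zero H)
  exact ⟨F.comp ⟨fun x => (1, x), by fun_prop⟩, (hF1 1).trans H.eval_one,
    ⟨⟨F, hF0, fun x => rfl⟩⟩⟩

theorem Path.Homotopy.continuous_reflTransSymm {T : Type*} [TopologicalSpace T]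
    {k : T → Path w w} (hk : Continuous k) {q : T → I × I} (hq : Continuous q) :
    Continuous fun r => Path.Homotopy.reflTransSymm (k r) (q r) := by
  change Continuous fun r => k r ⟨reflTransSymmAux (q r), reflTransSymmAux_mem_I _⟩
  fun_prop

/-- Freely homotopic based families of loops are based homotopic. -/
theorem WellPointed.homotopicRel_of_homotopic [T1Space X] {x₀ : X} (hX : WellPointed X x₀)
    {g g' : C(X, Path w w)} (hg : g x₀ = Path.refl w) (hg' : g' x₀ = Path.refl w)
    (h : g.Homotopic g') : g.HomotopicRel g' {x₀} := by
  obtain ⟨K⟩ := h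
  have hk0 : K (0, x₀) = Path.refl w := (K.apply_zero x₀).trans hg
  have hk1 : K (1, x₀) = Path.refl w := (K.apply_one x₀).trans hg'
  -- Correct the free homotopy by the inverse of its track at x₀: at x₀ it becomes k · k⁻¹, which
  -- contracts canonically. Extending that contraction over X makes the corrected homotopy constant
  -- at x₀.
  let f : C(X, C(I, Path w w)) := ⟨fun x => ⟨fun t => (K (t, x)).trans (K (t, x₀)).symm, by
      have := Path.continuous_symm (x := w) (y := w)
      fun_prop⟩,
    ContinuousMap.continuous_of_continuous_uncurry _ (by
      have := Path.continuous_symm (x := w) (y := w)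
      change Continuous fun q : X × I => (K (q.2, q.1)).trans (K (q.2, x₀)).symm
      fun_prop)⟩
  have key : Continuous fun r : (I × I) × I =>
      (Path.Homotopy.reflTransSymm (K (r.1.2, x₀))) (unitInterval.symm r.1.1, r.2) :=
    Path.Homotopy.continuous_reflTransSymm (by fun_prop) (by fun_prop)
  have key' : Continuous fun r : I × I =>
      (Path.Homotopy.reflTransSymm (K (r.2, x₀))).eval (unitInterval.symm r.1) :=
    Path.continuous_uncurry_iff.1 key
  -- The contraction `reflTransSymm` runs from the constant loop to k · k⁻¹, hence the reversal of
  -- the parameter.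
  let γ : C(I, C(I, Path w w)) := ContinuousMap.curry ⟨_, key'⟩
  have hγ0 : γ 0 = f x₀ := by
    ext1 t
    change (Path.Homotopy.reflTransSymm (K (t, x₀))).eval (unitInterval.symm 0) = _
    rw [unitInterval.symm_zero, Path.Homotopy.eval_one]
    rfl
  have hγ1 : ∀ t, γ 1 t = Path.refl w := by
    intro t
    change (Path.Homotopy.reflTransSymm (K (t, x₀))).eval (unitInterval.symm 1) = _
    rw [unitInterval.symm_one, Path.Homotopy.eval_zero]
  -- For t = 0, 1 the track is already constant, so the contraction does not move it; this keeps the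
  -- comparison at the two ends relative to x₀.
  have hγ : ∀ s t, K (t, x₀) = Path.refl w → γ s t = Path.refl w := by
    intro s t ht
    change (Path.Homotopy.reflTransSymm (K (t, x₀))).eval (unitInterval.symm s) = _
    rw [ht]
    rfl
  obtain ⟨F, hF0, hF1⟩ := hX.exists_extension f γ hγ0
  -- Each end of the corrected homotopy is g₁ followed by a constant loop at s = 0, and is then
  -- deformed by F relative to x₀.
  have hend : ∀ (g₁ : C(X, Path w w)) (t : I), g₁ x₀ = Path.refl w → (∀ x, K (t, x) = g₁ x) →
      g₁.HomotopicRel ⟨fun x => F (1, x) t, by fun_prop⟩ {x₀} := by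
    intro g₁ t h0 hK
    have hK0 := (hK x₀).trans h0
    refine (homotopicRel_trans_refl h0 ⟨fun x => F (0, x) t, by fun_prop⟩ fun x => ?_).symm.trans
      ⟨⟨⟨⟨fun q => F q t, by fun_prop⟩, fun x => rfl, fun x => rfl⟩, fun s x hx => ?_⟩⟩
    · change F (0, x) t = _
      rw [hF0]
      change (K (t, x)).trans (K (t, x₀)).symm = _
      rw [hK0, hK]
      rfl
    · obtain rfl := Set.mem_singleton_iff.1 hx
      change F (s, x) t = F (0, x) t
      rw [hF1, hF1, hγ _ _ hK0, hγ _ _ hK0]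
  refine ((hend g 0 hg K.apply_zero).trans ?_).trans (hend g' 1 hg' K.apply_one).symm
  refine ⟨⟨⟨⟨fun q => F (1, q.2) q.1, by fun_prop⟩, fun x => rfl, fun x => rfl⟩,
    fun t x hx => ?_⟩⟩
  obtain rfl := Set.mem_singleton_iff.1 hx
  change F (1, x) t = F (1, x) 0
  rw [hF1, hγ1, hγ1]

end LoopFamilies

/-! ### Based maps on ΣX as based families of loops -/

section Suspension

variable {X : Type u} {W W' : Type*} [TopologicalSpace X] [TopologicalSpace W]
  [TopologicalSpace W'] {w : W} {w' : W'} (x₀ : X)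

/-- `SuspRel` relates any two points of the collapsed set and nothing else, so the equivalence
relation it generates only adds the diagonal. -/
theorem ReducedSuspension.isCollapse :
    IsCollapse (⟨Quot.mk _, continuous_quot_mk⟩ : C(X × I, ReducedSuspension x₀))
      {p | p.2 = 0 ∨ p.2 = 1 ∨ p.1 = x₀} (ReducedSuspension.base x₀) where
  isQuotientMap := isQuotientMap_quot_mk
  nonempty := ⟨(x₀, 0), Or.inl rfl⟩
  map_eq p hp := Quot.sound ⟨hp, Or.inl rfl⟩
  eq_or_mem p q h := by
    have h' : Relation.EqvGen (SuspRel x₀) p q := Quot.eqvGen_exact h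
    induction h' with
    | rel _ _ hr => exact Or.inr hr
    | refl _ => exact Or.inl rfl
    | symm _ _ _ ih =>
      rcases ih (Quot.eqvGen_sound (by assumption)) with rfl | ⟨h1, h2⟩
      · exact Or.inl rfl
      · exact Or.inr ⟨h2, h1⟩
    | trans _ _ _ h1 h2 ih1 ih2 =>
      rcases ih1 (Quot.eqvGen_sound h1) with rfl | ⟨h1, h1'⟩
      · exact ih2 (Quot.eqvGen_sound h2)
      · rcases ih2 (Quot.eqvGen_sound h2) with rfl | ⟨h2, h2'⟩
        · exact Or.inr ⟨h1, h1'⟩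
        · exact Or.inr ⟨h1, h2'⟩

variable {x₀}

/-- The family of loops adjoint to a based map on the suspension. -/
def suspFamily (f : C(ReducedSuspension x₀, W)) (hf : f (ReducedSuspension.base x₀) = w) :
    C(X, Path w w) where
  toFun x := ⟨⟨fun t => f (Quot.mk _ (x, t)), by
      exact f.continuous.comp (continuous_quot_mk.comp (by fun_prop))⟩,
    (congrArg f ((ReducedSuspension.isCollapse x₀).map_eq (x, 0) (Or.inl rfl))).trans hf,
    (congrArg f ((ReducedSuspension.isCollapse x₀).map_eq (x, 1) (Or.inr (Or.inl rfl)))).trans hf⟩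
  continuous_toFun := Path.continuous_uncurry_iff.1 (f.continuous.comp continuous_quot_mk)

theorem suspFamily_base (f : C(ReducedSuspension x₀, W))
    (hf : f (ReducedSuspension.base x₀) = w) : suspFamily f hf x₀ = Path.refl w := by
  ext t
  exact (congrArg f
    ((ReducedSuspension.isCollapse x₀).map_eq (x₀, t) (Or.inr (Or.inr rfl)))).trans hf

theorem exists_suspFamily_eq (g : C(X, Path w w)) (hg : g x₀ = Path.refl w) :
    ∃ f hf, suspFamily (x₀ := x₀) f hf = g := by
  obtain ⟨f, hf, h⟩ := (ReducedSuspension.isCollapse x₀).exists_lift (w := w)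
    ⟨fun p => g p.1 p.2, by fun_prop⟩ (by
      rintro ⟨x, t⟩ (rfl | rfl | rfl)
      · exact (g x).source
      · exact (g x).target
      · exact congrArg (fun p : Path w w => p t) hg)
  refine ⟨f, hf, ?_⟩
  ext x t
  exact DFunLike.congr_fun h (x, t)

/-- The three collapsed pieces separate: the two ends are built into the type `Path w w`, and the
line over x₀ becomes the condition relative to x₀. -/
theorem homotopicRel_iff_suspFamily {f f' : C(ReducedSuspension x₀, W)}
    {hf : f (ReducedSuspension.base x₀) = w} {hf' : f' (ReducedSuspension.base x₀) = w} :
    f.HomotopicRel f' {ReducedSuspension.base x₀} ↔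
      (suspFamily f hf).HomotopicRel (suspFamily f' hf') {x₀} := by
  rw [(ReducedSuspension.isCollapse x₀).homotopicRel_iff hf]
  constructor
  · rintro ⟨F⟩
    have hF : ∀ s (p : X × I), (p.2 = 0 ∨ p.2 = 1 ∨ p.1 = x₀) → F (s, p) = w := fun s p hp =>
      (F.eq_fst s hp).trans
        ((congrArg f ((ReducedSuspension.isCollapse x₀).map_eq p hp)).trans hf)
    refine ⟨⟨⟨⟨fun q => ⟨⟨fun t => F (q.1, (q.2, t)), by fun_prop⟩, hF _ _ (Or.inl rfl),
      hF _ _ (Or.inr (Or.inl rfl))⟩, Path.continuous_uncurry_iff.1 ?_⟩, fun x => ?_,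
      fun x => ?_⟩, fun s x hx => ?_⟩⟩
    · change Continuous fun r : (I × X) × I => F (r.1.1, (r.1.2, r.2))
      fun_prop
    · ext t
      exact F.apply_zero (x, t)
    · ext t
      exact F.apply_one (x, t)
    · obtain rfl := Set.mem_singleton_iff.1 hx
      ext t
      exact F.eq_fst s (Or.inr (Or.inr rfl))
  · rintro ⟨K⟩
    refine ⟨⟨⟨⟨fun q => K (q.1, q.2.1) q.2.2, by fun_prop⟩, fun p => ?_, fun p => ?_⟩,
      fun s p hp => ?_⟩⟩
    · exact congrArg (fun r : Path w w => r p.2) (K.apply_zero p.1)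
    · exact congrArg (fun r : Path w w => r p.2) (K.apply_one p.1)
    · obtain ⟨x, t⟩ := p
      refine Eq.trans ?_
        ((congrArg f ((ReducedSuspension.isCollapse x₀).map_eq (x, t) hp)).trans hf).symm
      rcases hp with h | h | h
      · obtain rfl : t = 0 := h
        exact (K (s, x)).source
      · obtain rfl : t = 1 := h
        exact (K (s, x)).target
      · obtain rfl : x = x₀ := h
        exact congrArg (fun r : Path w w => r t)
          ((K.eq_fst s (Set.mem_singleton x)).trans (suspFamily_base f hf))

end Suspension

/-! ### Loops in the mapping space out of a co-split suspension -/

section LoopClasses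

variable {W W' W'' : Type*} [TopologicalSpace W] [TopologicalSpace W'] [TopologicalSpace W'']
  {w : W} {w' : W'} {w'' : W''}

/-- The map induced by a based map on homotopy classes of loops. -/
def loopMap (f : C(W, W')) (hf : f w = w') (P : Path.Homotopic.Quotient w w) :
    Path.Homotopic.Quotient w' w' :=
  (P.map f).cast hf.symm hf.symm

theorem loopMap_loopMap (f : C(W, W')) (hf : f w = w') (g : C(W', W'')) (hg : g w' = w'')
    (P : Path.Homotopic.Quotient w w) :
    loopMap g hg (loopMap f hf P) = loopMap (g.comp f) (by simp [hf, hg]) P := by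
  subst hf
  subst hg
  obtain ⟨p, rfl⟩ := Path.Homotopic.Quotient.mk_surjective P
  rfl

theorem loopMap_eq_self (f : C(W, W)) (h : ∀ x, f x = x) (P : Path.Homotopic.Quotient w w) :
    loopMap f (h w) P = P := by
  obtain rfl : f = ContinuousMap.id W := ContinuousMap.ext h
  obtain ⟨p, rfl⟩ := Path.Homotopic.Quotient.mk_surjective P
  rfl

theorem loopMap_trans (f : C(W, W')) (hf : f w = w') (P Q : Path.Homotopic.Quotient w w) :
    loopMap f hf (P.trans Q) = (loopMap f hf P).trans (loopMap f hf Q) := by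
  subst hf
  obtain ⟨p, rfl⟩ := Path.Homotopic.Quotient.mk_surjective P
  obtain ⟨q, rfl⟩ := Path.Homotopic.Quotient.mk_surjective Q
  exact congrArg Path.Homotopic.Quotient.mk (Path.map_trans p q f.continuous)

theorem loopMap_symm (f : C(W, W')) (hf : f w = w') (P : Path.Homotopic.Quotient w w) :
    loopMap f hf P.symm = (loopMap f hf P).symm := by
  subst hf
  obtain ⟨p, rfl⟩ := Path.Homotopic.Quotient.mk_surjective P
  rfl

theorem loopMap_bijective (e : W ≃ₜ W') (he : e w = w') :
    Function.Bijective (loopMap (e : C(W, W')) he) := by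
  rw [Function.bijective_iff_has_inverse]
  refine ⟨loopMap (e.symm : C(W', W)) (by simp [← he]), fun P => ?_, fun P => ?_⟩
  · rw [loopMap_loopMap]
    exact loopMap_eq_self _ (by simp) P
  · rw [loopMap_loopMap]
    exact loopMap_eq_self _ (by simp) P

end LoopClasses

/-! ### The split evaluation sequence for loops in a mapping space -/

section Splitting

variable {X : Type u} {W W' : Type*} [TopologicalSpace X] [TopologicalSpace W]
  [TopologicalSpace W'] {w : W} {w' : W'} {x₀ : X}

/-- Postcomposition, as a continuous map between mapping spaces. -/
def ContinuousMap.postcompMap (X : Type*) [TopologicalSpace X] (f : C(W, W')) :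
    C(C(X, W), C(X, W')) :=
  ⟨f.comp, f.continuous_postcomp⟩

theorem ContinuousMap.postcompMap_const (f : C(W, W')) (hf : f w = w') :
    ContinuousMap.postcompMap X f (ContinuousMap.const X w) = ContinuousMap.const X w' :=
  ContinuousMap.ext fun _ => hf

/-- Evaluation at a point, as a map on the mapping space. -/
def ContinuousMap.evalAt (W : Type*) [TopologicalSpace W] (x : X) : C(C(X, W), W) :=
  ⟨fun f => f x, continuous_eval_const x⟩

theorem ContinuousMap.evalAt_const (x : X) (w : W) :
    ContinuousMap.evalAt W x (ContinuousMap.const X w) = w := rfl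

theorem ContinuousMap.const'_apply (w : W) :
    (ContinuousMap.const' : C(W, C(X, W))) w = ContinuousMap.const X w := rfl

variable [LocallyCompactSpace X]

/-- A based map on the suspension gives a loop in the mapping space. -/
def suspToLoop (w : W) : BasedClasses (ReducedSuspension.base x₀) w →
    Path.Homotopic.Quotient (ContinuousMap.const X w) (ContinuousMap.const X w) :=
  Quotient.map (sa := BasedClasses.setoid _ w) (sb := Path.Homotopic.setoid _ _)
    (fun f => pathOfFamily (suspFamily f.1 f.2))
    (fun _ _ h => pathOfFamily_homotopic_iff.2 (homotopicRel_iff_suspFamily.1 h).homotopic)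

theorem suspToLoop_injective [T1Space X] (hX : WellPointed X x₀) (w : W) :
    Function.Injective (suspToLoop (x₀ := x₀) w) := by
  intro z z' h
  obtain ⟨f, hf, rfl⟩ := BasedClasses.mk_surjective z
  obtain ⟨g, hg, rfl⟩ := BasedClasses.mk_surjective z'
  have h' := pathOfFamily_homotopic_iff.1 (Path.Homotopic.Quotient.exact h)
  exact BasedClasses.mk_eq_mk.2 (homotopicRel_iff_suspFamily.2
    (hX.homotopicRel_of_homotopic (suspFamily_base f hf) (suspFamily_base g hg) h'))

theorem loopMap_evalAt_suspToLoop (z : BasedClasses (ReducedSuspension.base x₀) w) :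
    loopMap (ContinuousMap.evalAt W x₀) (ContinuousMap.evalAt_const x₀ w) (suspToLoop w z) =
      Path.Homotopic.Quotient.refl w := by
  obtain ⟨f, hf, rfl⟩ := BasedClasses.mk_surjective z
  exact congrArg Path.Homotopic.Quotient.mk (suspFamily_base f hf)

/-- Exactness at the middle of [ΣX, W] → π₁(map(X,W)) → π₁(W): a family of loops that is null at x₀
can be deformed to a based one. -/
theorem exists_suspToLoop_eq [T1Space X] (hX : WellPointed X x₀)
    (P : Path.Homotopic.Quotient (ContinuousMap.const X w) (ContinuousMap.const X w))
    (hP : loopMap (ContinuousMap.evalAt W x₀) (ContinuousMap.evalAt_const x₀ w) P = Path.Homotopic.Quotient.refl w) :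
    ∃ z : BasedClasses (ReducedSuspension.base x₀) w, suspToLoop w z = P := by
  obtain ⟨p, rfl⟩ := Path.Homotopic.Quotient.mk_surjective P
  obtain ⟨g, hg, h⟩ := hX.exists_based_family (familyOfPath p)
    (Path.Homotopic.Quotient.exact hP)
  obtain ⟨f, hf, rfl⟩ := exists_suspFamily_eq g hg
  exact ⟨BasedClasses.mk f hf, Path.Homotopic.Quotient.eq.2 (pathOfFamily_homotopic_iff.2 h.symm)⟩

/-- The combination of a based map on the suspension and a constant family of loops. -/
noncomputable def splitLoop (w : W)
    (z : Path.Homotopic.Quotient w w × BasedClasses (ReducedSuspension.base x₀) w) :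
    Path.Homotopic.Quotient (ContinuousMap.const X w) (ContinuousMap.const X w) :=
  (suspToLoop w z.2).trans (loopMap ContinuousMap.const' (ContinuousMap.const'_apply w) z.1)

theorem splitLoop_map (f : C(W, W')) (hf : f w = w')
    (z : Path.Homotopic.Quotient w w × BasedClasses (ReducedSuspension.base x₀) w) :
    splitLoop w' (loopMap f hf z.1, BasedClasses.map _ f hf z.2) =
      loopMap (ContinuousMap.postcompMap X f) (ContinuousMap.postcompMap_const f hf)
        (splitLoop w z) := by
  obtain ⟨P, z⟩ := z
  simp only [splitLoop]
  rw [loopMap_trans, loopMap_loopMap, loopMap_loopMap]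
  subst hf
  obtain ⟨p, rfl⟩ := Path.Homotopic.Quotient.mk_surjective P
  obtain ⟨g, hg, rfl⟩ := BasedClasses.mk_surjective z
  rfl

/-- Constant families are a section of evaluation, and its kernel is [ΣX, W]; so each P factors
uniquely as (P · Q'⁻¹) · Q', with Q' the constant family on the value of P at x₀. -/
theorem splitLoop_bijective [T1Space X] (hX : WellPointed X x₀) (w : W) :
    Function.Bijective (splitLoop (x₀ := x₀) w) := by
  have hev : ∀ P : Path.Homotopic.Quotient w w, loopMap (ContinuousMap.evalAt W x₀) (ContinuousMap.evalAt_const x₀ w)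
      (loopMap ContinuousMap.const' (ContinuousMap.const'_apply w) P) = P := fun P => by
    rw [loopMap_loopMap]
    exact loopMap_eq_self _ (fun _ => rfl) P
  constructor
  · rintro ⟨P, z⟩ ⟨P', z'⟩ h
    have h1 := congrArg (loopMap (ContinuousMap.evalAt W x₀) (ContinuousMap.evalAt_const x₀ w)) h
    simp only [splitLoop, loopMap_trans, loopMap_evalAt_suspToLoop, hev,
      Path.Homotopic.Quotient.refl_trans] at h1
    subst h1
    have h2 := congrArg (fun Q => Path.Homotopic.Quotient.trans Q
      (loopMap ContinuousMap.const' (ContinuousMap.const'_apply w) P).symm) h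
    simp only [splitLoop, Path.Homotopic.Quotient.trans_assoc,
      Path.Homotopic.Quotient.trans_symm, Path.Homotopic.Quotient.trans_refl] at h2
    rw [suspToLoop_injective hX w h2]
  · intro P
    let Q := loopMap (ContinuousMap.evalAt W x₀) (ContinuousMap.evalAt_const x₀ w) P
    let Q' := loopMap (ContinuousMap.const' : C(W, C(X, W))) (ContinuousMap.const'_apply w) Q
    have hs : loopMap (ContinuousMap.evalAt W x₀) (ContinuousMap.evalAt_const x₀ w) Q'.symm =
        Q.symm :=
      (loopMap_symm _ _ Q').trans (congrArg Path.Homotopic.Quotient.symm (hev Q))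
    obtain ⟨z, hz⟩ := exists_suspToLoop_eq hX (P.trans Q'.symm) (by
      rw [loopMap_trans, hs, Path.Homotopic.Quotient.trans_symm])
    refine ⟨(Q, z), ?_⟩
    rw [splitLoop, hz, Path.Homotopic.Quotient.trans_assoc, Path.Homotopic.Quotient.symm_trans,
      Path.Homotopic.Quotient.trans_refl]

end Splitting

/-! ### Homotopy groups of iterated loop spaces and of mapping spaces -/

section IteratedLoops

variable {N M K X : Type*} {Z Z' Z'' : Type*} [TopologicalSpace X] [TopologicalSpace Z]
  [TopologicalSpace Z'] [TopologicalSpace Z''] {z : Z} {z' : Z'} {z'' : Z''}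

/-- Homotopy classes become path components of the loop space, so homeomorphisms between iterated
loop spaces induce bijections on them. -/
theorem GenLoop.homotopic_iff_joined {p q : GenLoop N Z z} :
    GenLoop.Homotopic p q ↔ Joined p q := by
  constructor
  · rintro ⟨F⟩
    refine ⟨⟨⟨fun t => ⟨F.toHomotopy.curry t, fun y hy => (F.eq_fst t hy).trans (p.2 y hy)⟩,
      by fun_prop⟩, ?_, ?_⟩⟩
    · ext y
      exact F.apply_zero y
    · ext y
      exact F.apply_one y
  · rintro ⟨γ⟩
    refine ⟨⟨⟨⟨fun r => γ r.1 r.2, by fun_prop⟩, fun y => ?_, fun y => ?_⟩, fun t y hy => ?_⟩⟩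
    · exact congrArg (fun p : GenLoop N Z z => p y) γ.source
    · exact congrArg (fun p : GenLoop N Z z => p y) γ.target
    · exact ((γ t).2 y hy).trans (p.2 y hy).symm

/-- The map of iterated loop spaces induced by a based map. -/
def GenLoop.postcompMap (M : Type*) (f : C(Z, Z')) (hf : f z = z') :
    C(GenLoop M Z z, GenLoop M Z' z') :=
  ⟨GenLoop.postcomp f hf, (f.continuous_postcomp.comp continuous_subtype_val).subtype_mk _⟩

theorem GenLoop.postcompMap_const (f : C(Z, Z')) (hf : f z = z') :
    GenLoop.postcompMap M f hf GenLoop.const = GenLoop.const :=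
  GenLoop.ext _ _ fun _ => hf

theorem HomotopyGroup.mapOf_mapOf (f : C(Z, Z')) (hf : f z = z') (g : C(Z', Z'')) (hg : g z' = z'')
    (a : HomotopyGroup N Z z) :
    mapOf N g hg (mapOf N f hf a) = mapOf N (g.comp f) (by simp [hf, hg]) a := by
  obtain ⟨p⟩ := a
  rfl

theorem HomotopyGroup.mapOf_eq_self (f : C(Z, Z)) (h : ∀ x, f x = x) (a : HomotopyGroup N Z z) :
    mapOf N f (h z) a = a := by
  obtain rfl : f = ContinuousMap.id Z := ContinuousMap.ext h
  obtain ⟨p⟩ := a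
  rfl

/-- The homotopy groups of an iterated loop space. -/
def HomotopyGroup.ofLoops {A : Type*} (e : A ⊕ M ≃ K) (Z : Type*) [TopologicalSpace Z] (z : Z) :
    HomotopyGroup A (GenLoop M Z z) GenLoop.const ≃ HomotopyGroup K Z z :=
  Quotient.congr (ra := GenLoop.Homotopic.setoid _ _) (rb := GenLoop.Homotopic.setoid _ _)
    ((GenLoop.genLoopGenLoopEquiv z).trans (GenLoop.congr z e)).toEquiv fun p q => by
      refine GenLoop.homotopic_iff_joined.trans (Iff.trans ?_ GenLoop.homotopic_iff_joined.symm)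
      let h := (GenLoop.genLoopGenLoopEquiv (M := A) (N := M) z).trans (GenLoop.congr z e)
      refine ⟨fun ⟨γ⟩ => ⟨γ.map h.continuous⟩, fun ⟨γ⟩ => ⟨(γ.map h.symm.continuous).cast ?_ ?_⟩⟩
      · exact (h.symm_apply_apply p).symm
      · exact (h.symm_apply_apply q).symm

variable [DecidableEq N] (i : N)

/-- A homotopy group as a set of homotopy classes of loops in an iterated loop space. -/
def HomotopyGroup.toLoops (Z : Type*) [TopologicalSpace Z] (z : Z) :
    HomotopyGroup N Z z ≃ Path.Homotopic.Quotient
      (GenLoop.const : GenLoop {j // j ≠ i} Z z) GenLoop.const :=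
  Quotient.congr (ra := GenLoop.Homotopic.setoid _ _) (rb := Path.Homotopic.setoid _ _)
    (GenLoop.loopHomeo i).toEquiv fun _ _ => ⟨GenLoop.homotopicTo i, GenLoop.homotopicFrom i⟩

theorem HomotopyGroup.toLoops_mapOf (f : C(Z, Z')) (hf : f z = z') (a : HomotopyGroup N Z z) :
    toLoops i Z' z' (mapOf N f hf a) =
      loopMap (GenLoop.postcompMap _ f hf) (GenLoop.postcompMap_const f hf) (toLoops i Z z a) := by
  obtain ⟨p⟩ := a
  rfl

/-- Families of iterated loops as iterated loops in the mapping space. -/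
def GenLoop.mapHomeomorph (M X : Type*) [TopologicalSpace X] [LocallyCompactSpace X] (z : Z) :
    GenLoop M C(X, Z) (ContinuousMap.const X z) ≃ₜ C(X, GenLoop M Z z) where
  toFun p := ⟨fun x => ⟨⟨fun t => p t x, by fun_prop⟩, fun t ht =>
      congrArg (fun f : C(X, Z) => f x) (p.2 t ht)⟩,
    (ContinuousMap.continuous_of_continuous_uncurry _ (by
      change Continuous fun r : X × (M → I) => p r.2 r.1
      fun_prop)).subtype_mk _⟩
  invFun g := ⟨⟨fun t => ⟨fun x => g x t, by fun_prop⟩,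
    ContinuousMap.continuous_of_continuous_uncurry _ (by
      change Continuous fun r : (M → I) × X => g r.2 r.1
      fun_prop)⟩, fun t ht => ContinuousMap.ext fun x => (g x).2 t ht⟩
  left_inv _ := rfl
  right_inv _ := rfl
  continuous_toFun := ContinuousMap.continuous_of_continuous_uncurry _
    ((ContinuousMap.continuous_of_continuous_uncurry _ (by
      change Continuous fun r : (GenLoop M C(X, Z) (ContinuousMap.const X z) × X) × (M → I) =>
        r.1.1 r.2 r.1.2
      fun_prop)).subtype_mk _)
  continuous_invFun := (ContinuousMap.continuous_of_continuous_uncurry _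
    (ContinuousMap.continuous_of_continuous_uncurry _ (by
      change Continuous fun r : (C(X, GenLoop M Z z) × (M → I)) × X => r.1.1 r.2 r.1.2
      fun_prop))).subtype_mk _

theorem GenLoop.mapHomeomorph_const [LocallyCompactSpace X] :
    GenLoop.mapHomeomorph M X z GenLoop.const = ContinuousMap.const X GenLoop.const := rfl

/-- A homotopy group of a mapping space as a set of loops in a mapping space. -/
noncomputable def HomotopyGroup.mapToLoops (X : Type*) [TopologicalSpace X] [LocallyCompactSpace X]
    (Z : Type*) [TopologicalSpace Z] (z : Z) :
    HomotopyGroup N C(X, Z) (ContinuousMap.const X z) ≃ Path.Homotopic.Quotient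
      (ContinuousMap.const X (GenLoop.const : GenLoop {j // j ≠ i} Z z))
      (ContinuousMap.const X GenLoop.const) :=
  (toLoops i _ _).trans (Equiv.ofBijective _
    (loopMap_bijective (GenLoop.mapHomeomorph _ X z) GenLoop.mapHomeomorph_const))

theorem HomotopyGroup.mapToLoops_mapOf [LocallyCompactSpace X] (f : C(Z, Z')) (hf : f z = z')
    (a : HomotopyGroup N C(X, Z) (ContinuousMap.const X z)) :
    mapToLoops i X Z' z' (mapOf N (ContinuousMap.postcompMap X f)
      (ContinuousMap.postcompMap_const f hf) a) =
      loopMap (ContinuousMap.postcompMap X (GenLoop.postcompMap _ f hf))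
        (ContinuousMap.postcompMap_const _ (GenLoop.postcompMap_const f hf))
        (mapToLoops i X Z z a) := by
  obtain ⟨p⟩ := a
  rfl

end IteratedLoops

/-! ### The natural splitting of π_n of a mapping space -/

section MappingSpaceSplitting

variable {N X : Type*} (i : N) [TopologicalSpace X] [LocallyCompactSpace X]
  [T1Space X] {x₀ : X} {J : Type*} {S : J → Type*} [∀ j, TopologicalSpace (S j)] {b : ∀ j, S j}
  {A : J → Type*} {K : J → Type*} (e : ∀ j, A j ⊕ {l // l ≠ i} ≃ K j) {q : ∀ j, C(A j → I, S j)}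
  (hq : ∀ j, IsCollapse (q j) (Cube.boundary (A j)) (b j))
  {s : C(ReducedSuspension x₀, Wedge b)} (hs : s (ReducedSuspension.base x₀) = Wedge.base b)
  {r : C(Wedge b, ReducedSuspension x₀)} (hr : r (Wedge.base b) = ReducedSuspension.base x₀)
  (hrs : (r.comp s).HomotopicRel (ContinuousMap.id _) {ReducedSuspension.base x₀})
  (hsr : (s.comp r).HomotopicRel (ContinuousMap.id _) {Wedge.base b})
  {Z Z' : Type*} [TopologicalSpace Z] [TopologicalSpace Z'] {z : Z} {z' : Z'}

/-- Based maps from a wedge of spheres to an iterated loop space. -/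
noncomputable def wedgeClassesEquiv (Z : Type*) [TopologicalSpace Z] (z : Z) :
    BasedClasses (Wedge.base b) (GenLoop.const : GenLoop {l // l ≠ i} Z z) ≃
      ∀ j, HomotopyGroup (K j) Z z :=
  (Equiv.ofBijective _ (BasedClasses.restrictWedge_bijective b _)).trans
    (Equiv.piCongrRight fun j =>
      (Equiv.ofBijective _ (BasedClasses.toHomotopyGroup_bijective (hq j) _)).trans
        (HomotopyGroup.ofLoops (e j) Z z))

theorem wedgeClassesEquiv_map (f : C(Z, Z')) (hf : f z = z')
    (a : BasedClasses (Wedge.base b) (GenLoop.const : GenLoop {l // l ≠ i} Z z)) (j : J) :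
    wedgeClassesEquiv i e hq Z' z' (BasedClasses.map _ (GenLoop.postcompMap _ f hf)
      (GenLoop.postcompMap_const f hf) a) j =
        HomotopyGroup.mapOf (K j) f hf (wedgeClassesEquiv i e hq Z z a j) := by
  obtain ⟨g, hg, rfl⟩ := BasedClasses.mk_surjective a
  rfl

variable [DecidableEq N]

/-- The homotopy groups of the mapping space out of a space whose suspension is a wedge of
spheres. -/
noncomputable def mapGroupEquiv (hX : WellPointed X x₀)
    (Z : Type*) [TopologicalSpace Z] (z : Z) :
    (HomotopyGroup N Z z × ∀ j, HomotopyGroup (K j) Z z) ≃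
      HomotopyGroup N C(X, Z) (ContinuousMap.const X z) :=
  ((Equiv.prodCongr (HomotopyGroup.toLoops i Z z) ((wedgeClassesEquiv i e hq Z z).symm.trans
    (Equiv.ofBijective _ 
      (BasedClasses.precomp_bijective hs hr hrs hsr GenLoop.const)))).trans
    (Equiv.ofBijective _ (splitLoop_bijective hX GenLoop.const))).trans
    (HomotopyGroup.mapToLoops i X Z z).symm

/-- Every stage of the bijection commutes with postcomposition. Used for ω, to compare images, and
for μ and the two projections of H × H, to obtain multiplicativity. -/
theorem mapGroupEquiv_mapOf (hX : WellPointed X x₀)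
    (f : C(Z, Z')) (hf : f z = z') (a : HomotopyGroup N Z z)
    (c : ∀ j, HomotopyGroup (K j) Z z) :
    mapGroupEquiv i e hq hs hr hrs hsr hX Z' z' (HomotopyGroup.mapOf N f hf a,
      fun j => HomotopyGroup.mapOf (K j) f hf (c j)) =
      HomotopyGroup.mapOf N (ContinuousMap.postcompMap X f)
        (ContinuousMap.postcompMap_const f hf) (mapGroupEquiv i e hq hs hr hrs hsr hX Z z (a, c)) := by
  obtain ⟨c, rfl⟩ := (wedgeClassesEquiv i e hq Z z).surjective c
  have hc : (fun j => HomotopyGroup.mapOf (K j) f hf (wedgeClassesEquiv i e hq Z z c j)) =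
      wedgeClassesEquiv i e hq Z' z' (BasedClasses.map _ (GenLoop.postcompMap _ f hf)
        (GenLoop.postcompMap_const f hf) c) :=
    funext fun j => (wedgeClassesEquiv_map i e hq f hf c j).symm
  rw [hc, mapGroupEquiv, mapGroupEquiv, Equiv.trans_apply, Equiv.symm_apply_eq,
    HomotopyGroup.mapToLoops_mapOf, Equiv.trans_apply, Equiv.trans_apply _ _ (a, _),
    Equiv.apply_symm_apply]
  simp only [Equiv.trans_apply, Equiv.prodCongr_apply, Prod.map_apply, Equiv.symm_apply_apply,
    Equiv.ofBijective_apply]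
  rw [← splitLoop_map, HomotopyGroup.toLoops_mapOf, BasedClasses.precomp_map]

end MappingSpaceSplitting

/-! ### Strictly unital multiplications -/

section Multiplication

variable {H H' Y Y' : Type*} [TopologicalSpace H] [TopologicalSpace H'] [TopologicalSpace Y]
  [TopologicalSpace Y'] {h : H} {h' : H'} {y : Y} {y' : Y'}

/-- A continuous multiplication on `H` with strict two-sided unit `h`. -/
structure IsUnitalMul (μ : C(H × H, H)) (h : H) : Prop where
  one_mul : ∀ a, μ (h, a) = a
  mul_one : ∀ a, μ (a, h) = a

/-- The pointwise multiplication on a mapping space. -/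
def ContinuousMap.pointwiseMul (X : Type*) [TopologicalSpace X] [LocallyCompactSpace X]
    (μ : C(H × H, H)) : C(C(X, H) × C(X, H), C(X, H)) :=
  ⟨fun p => μ.comp (p.1.prodMk p.2), ContinuousMap.continuous_of_continuous_uncurry _ (by
    change Continuous fun q : (C(X, H) × C(X, H)) × X => μ (q.1.1 q.2, q.1.2 q.2)
    fun_prop)⟩

theorem IsUnitalMul.pointwiseMul {μ : C(H × H, H)} (hμ : IsUnitalMul μ h) (X : Type*)
    [TopologicalSpace X] [LocallyCompactSpace X] :
    IsUnitalMul (ContinuousMap.pointwiseMul X μ) (ContinuousMap.const X h) :=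
  ⟨fun _ => ContinuousMap.ext fun _ => hμ.one_mul _,
    fun _ => ContinuousMap.ext fun _ => hμ.mul_one _⟩

namespace HomotopyGroup

theorem exists_mapOf_fst_snd {N : Type*} (a : HomotopyGroup N H h) (b : HomotopyGroup N H' h') :
    ∃ r : HomotopyGroup N (H × H') (h, h'), mapOf N ContinuousMap.fst rfl r = a ∧
      mapOf N ContinuousMap.snd rfl r = b := by
  obtain ⟨p⟩ := a
  obtain ⟨q⟩ := b
  exact ⟨Quotient.mk _ ⟨p.1.prodMk q.1, fun t ht => Prod.ext (p.2 t ht) (q.2 t ht)⟩, rfl, rfl⟩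

theorem homotopic_mul {N : Type*} {μ : C(H × H, H)} {p p' q q' r r' : GenLoop N H h}
    (hp : GenLoop.Homotopic p p') (hq : GenLoop.Homotopic q q') (hr : ∀ t, r t = μ (p t, q t))
    (hr' : ∀ t, r' t = μ (p' t, q' t)) : GenLoop.Homotopic r r' := by
  obtain ⟨F⟩ := hp
  obtain ⟨G⟩ := hq
  refine ⟨⟨⟨⟨fun x => μ (F x, G x), by fun_prop⟩, fun t => ?_, fun t => ?_⟩, fun s t ht => ?_⟩⟩
  · exact (congrArg μ (Prod.ext (F.apply_zero t) (G.apply_zero t))).trans (hr t).symm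
  · exact (congrArg μ (Prod.ext (F.apply_one t) (G.apply_one t))).trans (hr' t).symm
  · exact (congrArg μ (Prod.ext (F.eq_fst s ht) (G.eq_fst s ht))).trans (hr t).symm

/-- The Eckmann–Hilton principle: the group operation agrees with the pointwise product. -/
theorem mapOf_unitalMul {N : Type*} [DecidableEq N] [Nonempty N] {μ : C(H × H, H)}
    (hμ : IsUnitalMul μ h) (r : HomotopyGroup N (H × H) (h, h)) :
    mapOf N μ (hμ.one_mul h) r =
      mapOf N ContinuousMap.fst (w' := h) rfl r * mapOf N ContinuousMap.snd (w' := h) rfl r := by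
  obtain ⟨R⟩ := r
  let i : N := Classical.arbitrary N
  let p : GenLoop N H h := GenLoop.postcomp ContinuousMap.fst rfl R
  let q : GenLoop N H h := GenLoop.postcomp ContinuousMap.snd rfl R
  have hp : GenLoop.Homotopic p (GenLoop.transAt i GenLoop.const p) :=
    Quotient.exact (s := GenLoop.Homotopic.setoid N h)
      ((mul_one (M := HomotopyGroup N H h) (Quotient.mk _ p)).symm.trans
        (mul_spec (i := i) (p := p) (q := GenLoop.const)))
  have hq : GenLoop.Homotopic q (GenLoop.transAt i q GenLoop.const) :=
    Quotient.exact (s := GenLoop.Homotopic.setoid N h)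
      ((one_mul (M := HomotopyGroup N H h) (Quotient.mk _ q)).symm.trans
        (mul_spec (i := i) (p := GenLoop.const) (q := q)))
  -- Pad p by a constant in the first half and q in the second; the unit laws turn the pointwise
  -- product into q then p, which is how `mul_spec` represents the product p * q.
  refine Eq.trans (Quotient.sound (s := GenLoop.Homotopic.setoid N h)
    (homotopic_mul (μ := μ) hp hq (fun t => rfl) (r' := GenLoop.transAt i q p) fun t => ?_))
    (mul_spec (i := i) (p := p) (q := q)).symm
  simp only [GenLoop.transAt, GenLoop.coe_copy]
  split_ifs
  · exact (hμ.one_mul _).symm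
  · exact (hμ.mul_one _).symm

end HomotopyGroup

/-- The image of the homomorphism induced by a based map on the `n`-th homotopy groups. -/
noncomputable abbrev inducedRange (n : ℕ) [NeZero n] (f : C(H, Y)) (hf : f h = y) :
    Subgroup (HomotopyGroup.Pi n Y y) :=
  (inducedHom n f hf).range

/-- `Φ'` need not be a homomorphism on a whole ambient group: since `f` is onto, its
multiplicativity on P is forced by that of `Φ` upstairs. -/
theorem nonempty_range_mulEquiv {A P B B' : Type*} [Group A] [Group P] [Group B] [Group B']
    {f : A →* P} (hf : Function.Surjective f) (g : B →* B') {Φ : A → B}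
    (hΦ : ∀ a a', Φ (a * a') = Φ a * Φ a') (hΦs : Function.Surjective Φ) {Φ' : P → B'}
    (hΦ' : Function.Injective Φ') (h : ∀ a, Φ' (f a) = g (Φ a)) : Nonempty (P ≃* g.range) := by
  have hmem : ∀ p, Φ' p ∈ g.range := fun p => by
    obtain ⟨a, rfl⟩ := hf p
    exact ⟨Φ a, (h a).symm⟩
  let F : P →* g.range := MonoidHom.mk' (fun p => ⟨Φ' p, hmem p⟩) fun p p' => by
    obtain ⟨a, rfl⟩ := hf p
    obtain ⟨a', rfl⟩ := hf p'
    refine Subtype.ext ?_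
    change Φ' (f a * f a') = Φ' (f a) * Φ' (f a')
    rw [← map_mul, h, h, h, hΦ, map_mul]
  refine ⟨MulEquiv.ofBijective F ⟨fun p p' hp => hΦ' (Subtype.ext_iff.1 hp), ?_⟩⟩
  rintro ⟨_, b, rfl⟩
  obtain ⟨a, rfl⟩ := hΦs b
  exact ⟨f a, Subtype.ext (h a)⟩

theorem inducedRange_mulEquiv_of_homeomorph (n : ℕ) [NeZero n] {f : C(H, Y)} {hf : f h = y}
    {f' : C(H', Y')} {hf' : f' h' = y'} (e : H ≃ₜ H') (he : e h = h') (e' : Y ≃ₜ Y')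
    (he' : e' y = y') (hee' : ∀ a, e' (f a) = f' (e a)) :
    Nonempty (inducedRange n f hf ≃* inducedRange n f' hf') := by
  refine nonempty_range_mulEquiv (f := (inducedHom n f hf).rangeRestrict)
    (MonoidHom.rangeRestrict_surjective _) _
    (Φ := inducedHom n (e : C(H, H')) he) (Φ' := fun p => inducedHom n (e' : C(Y, Y')) he' p.1)
    (fun a a' => map_mul _ a a') ?_ ?_ ?_
  · intro b
    refine ⟨HomotopyGroup.mapOf _ (e.symm : C(H', H)) (by simp [← he]) b, ?_⟩
    refine (HomotopyGroup.mapOf_mapOf _ _ _ _ b).trans ?_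
    exact HomotopyGroup.mapOf_eq_self _ (by simp) b
  · intro p p' hpp'
    have := congrArg (HomotopyGroup.mapOf _ (e'.symm : C(Y', Y)) (w' := y) (by simp [← he'])) hpp'
    have key : ∀ b, HomotopyGroup.mapOf _ (e'.symm : C(Y', Y)) (w' := y) (by simp [← he'])
        (inducedHom n (e' : C(Y, Y')) he' b) = b := fun b =>
      (HomotopyGroup.mapOf_mapOf _ _ _ _ b).trans (HomotopyGroup.mapOf_eq_self _ (by simp) b)
    rw [key, key] at this
    exact Subtype.ext this
  · rintro ⟨p⟩
    exact congrArg (Quotient.mk _) (GenLoop.ext _ _ fun t => hee' _)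

end Multiplication

/-! ### Images of induced maps for a single factor -/

section OneFactor

variable {X : Type u} [TopologicalSpace X] [LocallyCompactSpace X] [T1Space X] {x₀ : X}
  {H Y : Type*} [TopologicalSpace H] [TopologicalSpace Y] {h : H} {y : Y}

/-- For a space whose suspension is a wedge of spheres, the image of the map induced on homotopy
groups of mapping spaces by a map out of a space with unital multiplication. -/
theorem inducedRange_postcompMap (hX : WellPointed X x₀) {k : ℕ} (d : Fin k → ℕ)
    (hS : BasedHomotopyEquivalent (ReducedSuspension.base x₀)
      (Wedge.base fun j : Fin k => Sphere.base (d j + 1)))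
    {μ : C(H × H, H)} (hμ : IsUnitalMul μ h) (ω : C(H, Y)) (hω : ω h = y) (n : ℕ) [NeZero n] :
    Nonempty ((inducedRange n ω hω × ∀ j, inducedRange (n + d j) ω hω) ≃*
      inducedRange n (ContinuousMap.postcompMap X ω) (ContinuousMap.postcompMap_const ω hω)) := by
  obtain ⟨s, r, hs, hr, hrs, hsr⟩ := hS
  choose q hq using fun j => Sphere.exists_isCollapse (d j + 1)
  -- Degrees add as (d_j + 1) + (n - 1) = n + d_j. Any bijection of coordinates will do, since only
  -- naturality is used.
  have e : ∀ j, Nonempty (Fin (d j + 1) ⊕ {l : Fin n // l ≠ 0} ≃ Fin (n + d j)) := fun j =>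
    ⟨Fintype.equivOfCardEq (by
      have := NeZero.pos n
      simp only [Fintype.card_sum, Fintype.card_fin, ne_eq, Fintype.card_subtype_compl,
        Fintype.card_unique]
      omega)⟩
  replace e := fun j => (e j).some
  let A := HomotopyGroup.Pi n H h × ∀ j, HomotopyGroup.Pi (n + d j) H h
  let f : A →* inducedRange n ω hω × ∀ j, inducedRange (n + d j) ω hω :=
    (inducedHom n ω hω).rangeRestrict.prodMap
      (MonoidHom.pi fun j => (inducedHom (n + d j) ω hω).rangeRestrict.comp (Pi.evalMonoidHom _ j))
  have hf : Function.Surjective f := by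
    rintro ⟨⟨_, a, rfl⟩, c⟩
    choose c' hc' using fun j => (c j).2
    exact ⟨(a, c'), Prod.ext rfl (funext fun j => Subtype.ext (hc' j))⟩
  refine nonempty_range_mulEquiv hf _ (Φ := mapGroupEquiv 0 e hq hs hr hrs hsr hX H h)
    (Φ' := fun p => mapGroupEquiv 0 e hq hs hr hrs hsr hX Y y (p.1.1, fun j => (p.2 j).1))
    ?_ (Equiv.surjective _) ?_ ?_
  · rintro ⟨a, c⟩ ⟨a', c'⟩
    obtain ⟨R, rfl, rfl⟩ := HomotopyGroup.exists_mapOf_fst_snd a a'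
    choose C hC hC' using fun j => HomotopyGroup.exists_mapOf_fst_snd (c j) (c' j)
    obtain rfl := funext hC
    obtain rfl := funext hC'
    have h1 := mapGroupEquiv_mapOf 0 e hq hs hr hrs hsr hX μ (hμ.one_mul h) R C
    have h2 := mapGroupEquiv_mapOf 0 e hq hs hr hrs hsr hX
      (ContinuousMap.fst : C(H × H, H)) (z := (h, h)) (z' := h) rfl R C
    have h3 := mapGroupEquiv_mapOf 0 e hq hs hr hrs hsr hX
      (ContinuousMap.snd : C(H × H, H)) (z := (h, h)) (z' := h) rfl R C
    set T := mapGroupEquiv 0 e hq hs hr hrs hsr hX (H × H) (h, h) (R, C)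
    -- Postcomposition with μ is κ followed by the pointwise product, so Eckmann–Hilton in map(X,H)
    -- computes its effect on `T`.
    let κ : C(C(X, H × H), C(X, H) × C(X, H)) :=
      (ContinuousMap.postcompMap X ContinuousMap.fst).prodMk
        (ContinuousMap.postcompMap X ContinuousMap.snd)
    have hκ : κ (ContinuousMap.const X (h, h)) =
      (ContinuousMap.const X h, ContinuousMap.const X h) := rfl
    have h4 := HomotopyGroup.mapOf_unitalMul (hμ.pointwiseMul X)
      (HomotopyGroup.mapOf (Fin n) κ hκ T)
    have h5 : HomotopyGroup.mapOf (Fin n) (ContinuousMap.postcompMap X μ)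
        (ContinuousMap.postcompMap_const μ (hμ.one_mul h)) T = _ :=
      (HomotopyGroup.mapOf_mapOf κ hκ (ContinuousMap.pointwiseMul X μ)
        ((hμ.pointwiseMul X).one_mul _) T).symm.trans (h4.trans (congrArg₂ (· * ·)
          (HomotopyGroup.mapOf_mapOf κ hκ ContinuousMap.fst rfl T)
          (HomotopyGroup.mapOf_mapOf κ hκ ContinuousMap.snd rfl T)))
    refine Eq.trans ?_ ((h1.trans h5).trans (congrArg₂ (· * ·) h2.symm h3.symm))
    refine congrArg _ (Prod.ext ?_ (funext fun j => ?_))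
    · exact (HomotopyGroup.mapOf_unitalMul hμ R).symm
    · exact (HomotopyGroup.mapOf_unitalMul hμ (C j)).symm
  · intro p p' hp
    have := (mapGroupEquiv 0 e hq hs hr hrs hsr hX Y y).injective hp
    rw [Prod.mk.injEq] at this
    exact Prod.ext (Subtype.ext this.1) (funext fun j => Subtype.ext (congrFun this.2 j))
  · rintro ⟨a, c⟩
    exact mapGroupEquiv_mapOf 0 e hq hs hr hrs hsr hX ω hω a c

end OneFactor

/-! ### Finite products -/

section Products

theorem nonempty_piMulEquiv {ι ι' : Type*} {G : ι → Type*} {G' : ι' → Type*} [∀ i, Group (G i)]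
    [∀ i, Group (G' i)] (e : ι ≃ ι') (h : ∀ i, Nonempty (G i ≃* G' (e i))) :
    Nonempty ((∀ i, G i) ≃* ∀ i, G' i) := by
  refine ⟨(MulEquiv.piCongrRight fun i => (h i).some).trans
    (MulEquiv.symm { Equiv.piCongrLeft' G' e.symm with map_mul' := fun _ _ => rfl })⟩

theorem nonempty_prodPi_mulEquiv_option {J : Type*} {A : Type*} {B : J → Type*}
    {G : Option J → Type*} [Group A] [∀ j, Group (B j)] [∀ o, Group (G o)]
    (hA : Nonempty (A ≃* G none)) (hB : ∀ j, Nonempty (B j ≃* G (some j))) :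
    Nonempty ((A × ∀ j, B j) ≃* ∀ o, G o) :=
  ⟨(MulEquiv.prodCongr hA.some (MulEquiv.piCongrRight fun j => (hB j).some)).trans
    (MulEquiv.symm { Equiv.piOptionEquivProd with map_mul' := fun _ _ => rfl })⟩

theorem nonempty_piCurry_mulEquiv {α β : Type*} {G : α × β → Type*} [∀ p, Group (G p)] :
    Nonempty ((∀ a b, G (a, b)) ≃* ∀ p, G p) :=
  ⟨{ toFun := fun f p => f p.1 p.2
     invFun := fun f a b => f (a, b)
     left_inv := fun _ => rfl
     right_inv := fun _ => rfl
     map_mul' := fun _ _ => rfl }⟩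

/-- Splitting off the first factor of a finite product of spaces. -/
def Fin.consHomeomorph {N : ℕ} (X : Fin (N + 1) → Type*) [∀ i, TopologicalSpace (X i)] :
    (X 0 × ∀ i : Fin N, X i.succ) ≃ₜ ∀ i, X i where
  toEquiv := Fin.consEquiv X
  continuous_toFun := by
    refine continuous_pi fun i => ?_
    induction i using Fin.cases with
    | zero => exact continuous_fst
    | succ i => exact (continuous_apply i).comp continuous_snd
  continuous_invFun := (continuous_apply 0).prodMk (continuous_pi fun i => continuous_apply i.succ)

/-- Splitting off the first factor of the source of a mapping space. -/
def ContinuousMap.consHomeomorph {N : ℕ} (X : Fin (N + 1) → Type*) [∀ i, TopologicalSpace (X i)]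
    [∀ i, LocallyCompactSpace (X i)] (Z : Type*) [TopologicalSpace Z] :
    C(∀ i, X i, Z) ≃ₜ C(X 0, C(∀ i : Fin N, X i.succ, Z)) :=
  (Homeomorph.arrowCongr (Fin.consHomeomorph X).symm (Homeomorph.refl Z)).trans Homeomorph.curry

theorem inducedRange_mulEquiv_of_eq {H Y : Type*} [TopologicalSpace H] [TopologicalSpace Y]
    {h : H} {y : Y} (f : C(H, Y)) (hf : f h = y) {n m : ℕ} [NeZero n] [NeZero m] (hnm : n = m) :
    Nonempty (inducedRange n f hf ≃* inducedRange m f hf) := by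
  subst hnm
  exact ⟨MulEquiv.refl _⟩

variable {H Y : Type*} [TopologicalSpace H] [TopologicalSpace Y] {h : H} {y : Y}

/-- Induction on the number of factors: the one-factor case for X₀ is applied with map(X',H) in
place of H, where X' is the product of the other factors. The degree `n` varies because the
inductive hypothesis is needed in degrees n and n + d_j. An unchosen factor contributes the default
degree 0. -/
theorem inducedRange_postcompMap_pi {μ : C(H × H, H)} (hμ : IsUnitalMul μ h) (ω : C(H, Y))
    (hω : ω h = y) {N : ℕ} {X : Fin N → Type u} [∀ i, TopologicalSpace (X i)]
    [∀ i, T2Space (X i)] [∀ i, LocallyCompactSpace (X i)] (x : ∀ i, X i)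
    (hx : ∀ i, WellPointed (X i) (x i)) (k : Fin N → ℕ) (d : ∀ i, Fin (k i) → ℕ)
    (hX : ∀ i, BasedHomotopyEquivalent (ReducedSuspension.base (x i))
      (Wedge.base fun j : Fin (k i) => Sphere.base (d i j + 1))) (n : ℕ) [NeZero n] :
    Nonempty (inducedRange n (ContinuousMap.postcompMap (∀ i, X i) ω)
      (ContinuousMap.postcompMap_const ω hω) ≃*
        ∀ s : ∀ i, Option (Fin (k i)), inducedRange (n + ∑ i, (s i).elim 0 (d i)) ω hω) := by
  induction N generalizing n with
  | zero =>
    obtain ⟨e⟩ := inducedRange_mulEquiv_of_homeomorph n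
      (f := ω) (hf := hω) (f' := ContinuousMap.postcompMap (∀ i, X i) ω)
      (hf' := ContinuousMap.postcompMap_const ω hω)
      (Homeomorph.continuousMapOfUnique (X := ∀ i, X i)) rfl
      (Homeomorph.continuousMapOfUnique (X := ∀ i, X i)) rfl (fun a => rfl)
    let G := fun s : ∀ i, Option (Fin (k i)) =>
      inducedRange (n + ∑ i, (s i).elim 0 (d i)) ω hω
    have e' : Nonempty (inducedRange n ω hω ≃* G default) :=
      inducedRange_mulEquiv_of_eq ω hω (by simp)
    exact ⟨(e.symm.trans e'.some).trans (MulEquiv.piUnique fun s => G s).symm⟩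
  | succ N ih =>
    obtain ⟨e₁⟩ := inducedRange_mulEquiv_of_homeomorph n
      (f := ContinuousMap.postcompMap (∀ i, X i) ω) (hf := ContinuousMap.postcompMap_const ω hω)
      (f' := ContinuousMap.postcompMap (X 0) (ContinuousMap.postcompMap (∀ i : Fin N, X i.succ) ω))
      (hf' := ContinuousMap.postcompMap_const _ (ContinuousMap.postcompMap_const ω hω))
      (ContinuousMap.consHomeomorph X H) rfl (ContinuousMap.consHomeomorph X Y) rfl fun _ => rfl
    obtain ⟨e₂⟩ := inducedRange_postcompMap (hx 0) (d 0) (hX 0)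
      (hμ.pointwiseMul (∀ i : Fin N, X i.succ)) (ContinuousMap.postcompMap _ ω)
      (ContinuousMap.postcompMap_const ω hω) n
    have ih' := fun (m : ℕ) [NeZero m] => ih (fun i => x i.succ) (fun i => hx i.succ)
      (fun i => k i.succ) (fun i => d i.succ) (fun i => hX i.succ) m
    obtain ⟨e₃⟩ := nonempty_prodPi_mulEquiv_option
      (G := fun o : Option (Fin (k 0)) => ∀ s : ∀ i : Fin N, Option (Fin (k i.succ)),
        inducedRange (n + o.elim 0 (d 0) + ∑ i, (s i).elim 0 (d i.succ)) ω hω)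
      (ih' n) (fun j => ih' (n + d 0 j))
    obtain ⟨e₄⟩ := nonempty_piCurry_mulEquiv
      (G := fun p : Option (Fin (k 0)) × ∀ i : Fin N, Option (Fin (k i.succ)) =>
        inducedRange (n + p.1.elim 0 (d 0) + ∑ i, (p.2 i).elim 0 (d i.succ)) ω hω)
    obtain ⟨e₅⟩ := nonempty_piMulEquiv
      (G := fun p : Option (Fin (k 0)) × ∀ i : Fin N, Option (Fin (k i.succ)) =>
        inducedRange (n + p.1.elim 0 (d 0) + ∑ i, (p.2 i).elim 0 (d i.succ)) ω hω)
      (G' := fun s : ∀ i, Option (Fin (k i)) =>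
        inducedRange (n + ∑ i, (s i).elim 0 (d i)) ω hω)
      (Fin.consEquiv fun i => Option (Fin (k i))) fun p =>
        inducedRange_mulEquiv_of_eq ω hω (by
          rw [Fin.sum_univ_succ, add_assoc]
          rfl)
    exact ⟨e₁.trans (e₂.symm.trans (e₃.trans (e₄.trans e₅)))⟩

end Products

/-! ### Gottlieb groups as images of maps between mapping spaces -/

section Gottlieb

variable {N X Y T T' : Type*} [TopologicalSpace X] [TopologicalSpace Y] [TopologicalSpace T]
  [TopologicalSpace T'] {y : Y}

/-- Scaling t to the corner 0 of the cube, which lies on the boundary when N is nonempty, shows that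
a cube of maps stays in the component of its boundary value. -/
theorem ContinuousMap.homotopic_of_cube (Q : C((N → I) × T, T')) (t : N → I) (f g : C(T, T'))
    (hf : ∀ a, f a = Q (t, a)) (hg : ∀ a, g a = Q (0, a)) : f.Homotopic g := by
  refine ContinuousMap.Homotopic.symm
    ⟨⟨⟨fun p => Q (fun i => p.1 * t i, p.2), by fun_prop⟩, fun a => ?_, fun a => ?_⟩⟩
  · simp only [zero_mul, hg]
    rfl
  · simp only [one_mul, hf]

theorem Cube.zero_mem_boundary [Nonempty N] : (0 : N → I) ∈ Cube.boundary N :=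
  ⟨Classical.arbitrary N, Or.inl rfl⟩

/-- A family of self-maps parametrized by a cube, trivial on the boundary, as an iterated loop. -/
theorem AutOne.exists_genLoop [Nonempty N] (Q : C((N → I) × T, T))
    (hQ : ∀ t ∈ Cube.boundary N, ∀ a, Q (t, a) = a) :
    ∃ p : GenLoop N (AutOne T) (AutOne.one T), ∀ t a, (p t).1 a = Q (t, a) := by
  have h : ∀ t, (Q.curry t).Homotopic (ContinuousMap.id T) := fun t =>
    ContinuousMap.homotopic_of_cube Q t _ _ (fun a => rfl)
      fun a => (hQ 0 Cube.zero_mem_boundary a).symm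
  exact ⟨⟨⟨fun t => ⟨Q.curry t, h t⟩, Q.curry.continuous.subtype_mk h⟩, fun t ht =>
    Subtype.ext (ContinuousMap.ext fun a => hQ t ht a)⟩, fun t a => rfl⟩

theorem gottliebGroup_eq_inducedRange [LocallyCompactSpace Y] (n : ℕ) [NeZero n] (y : Y) :
    gottliebGroup n Y y =
      inducedRange n (ContinuousMap.evalAt Y y) (h := ContinuousMap.id Y) rfl := by
  ext a
  constructor
  · rintro ⟨⟨p⟩, rfl⟩
    refine ⟨HomotopyGroup.mapOf (Fin n) (w := AutOne.one Y) (w' := ContinuousMap.id Y)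
      ⟨Subtype.val, continuous_subtype_val⟩ rfl (Quotient.mk _ p), rfl⟩
  · rintro ⟨⟨p⟩, rfl⟩
    obtain ⟨q, hq⟩ := AutOne.exists_genLoop (N := Fin n)
      (⟨fun r => p.1 r.1 r.2, by fun_prop⟩ : C((Fin n → I) × Y, Y)) (fun t ht a =>
        congrArg (fun f : C(Y, Y) => f a) (p.2 t ht))
    exact ⟨Quotient.mk _ q, congrArg (Quotient.mk _) (GenLoop.ext _ _ fun t => hq t y)⟩

/-- The inclusion of the null component into the mapping space. -/
def NullComponent.incl (X : Type*) {Y : Type*} [TopologicalSpace X] [TopologicalSpace Y] (y : Y) :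
    C(NullComponent X Y y, C(X, Y)) :=
  ⟨Subtype.val, continuous_subtype_val⟩

/-- A homotopy of loops in map(X,Y), relative to the boundary, never leaves the null component, so
it lifts. -/
theorem NullComponent.mapOf_incl_injective [LocallyCompactSpace X] [Nonempty N] :
    Function.Injective (HomotopyGroup.mapOf N (NullComponent.incl X y)
      (show NullComponent.incl X y (NullComponent.null X y) = ContinuousMap.const X y from rfl)) := by
  rintro ⟨p⟩ ⟨q⟩ hpq
  obtain ⟨F⟩ := Quotient.exact (s := GenLoop.Homotopic.setoid _ _) hpq
  have h : ∀ r, (F r).Homotopic (ContinuousMap.const X y) := by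
    intro r
    refine ContinuousMap.homotopic_of_cube (N := N)
      ⟨fun a : (N → I) × X => F (r.1, a.1) a.2, by fun_prop⟩ r.2 _ _ (fun a => rfl) fun a => ?_
    exact (congrArg (fun f : C(X, Y) => f a) ((F.eq_fst r.1 Cube.zero_mem_boundary).trans
      (congrArg Subtype.val (p.2 0 Cube.zero_mem_boundary)))).symm
  exact Quotient.sound (s := GenLoop.Homotopic.setoid _ _)
    ⟨⟨⟨⟨fun r => ⟨F r, h r⟩, F.continuous.subtype_mk h⟩, fun t => Subtype.ext (F.apply_zero t),
      fun t => Subtype.ext (F.apply_one t)⟩, fun s t ht => Subtype.ext (F.eq_fst s ht)⟩⟩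

theorem NullComponent.map_gottliebGroup [LocallyCompactSpace X] [LocallyCompactSpace Y]
    [PathConnectedSpace Y] (n : ℕ) [NeZero n] (y : Y) :
    (gottliebGroup n (NullComponent X Y y) (NullComponent.null X y)).map
      (inducedHom n (NullComponent.incl X y) (y := ContinuousMap.const X y) rfl) =
      inducedRange n (ContinuousMap.postcompMap X (ContinuousMap.evalAt Y y))
        (h := ContinuousMap.const X (ContinuousMap.id Y)) rfl := by
  ext a
  constructor
  · rintro ⟨_, ⟨⟨p⟩, rfl⟩, rfl⟩
    -- Path-connectedness of Y puts every constant map in the null component.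
    let c : C(Y, NullComponent X Y y) :=
      ⟨fun y' => ⟨ContinuousMap.const X y',
        ⟨(PathConnectedSpace.somePath y' y).toHomotopyConst⟩⟩,
        ContinuousMap.continuous_const'.subtype_mk _⟩
    -- Composing with `c` before uncurrying leaves Y as the source, so only local compactness of X
    -- and Y is needed.
    let P : (Fin n → I) → C(Y, C(X, Y)) := fun t =>
      ((NullComponent.incl X y).comp (p t).1).comp c
    have hP : Continuous P := by
      refine (ContinuousMap.continuous_precomp c).comp
        ((ContinuousMap.continuous_postcomp _).comp (continuous_subtype_val.comp ?_))
      fun_prop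
    refine ⟨Quotient.mk _ ⟨⟨fun t => ⟨fun x => ⟨fun y' => P t y' x, by fun_prop⟩, ?_⟩, ?_⟩,
      fun t ht => ?_⟩, ?_⟩
    · refine ContinuousMap.continuous_of_continuous_uncurry _ ?_
      change Continuous fun r : X × Y => P t r.2 r.1
      fun_prop
    · refine ContinuousMap.continuous_of_continuous_uncurry _
        (ContinuousMap.continuous_of_continuous_uncurry _ ?_)
      change Continuous fun r : ((Fin n → I) × X) × Y => P r.1.1 r.2 r.1.2
      fun_prop
    · ext x y'
      have := p.2 t ht
      exact congrArg (fun f : AutOne (NullComponent X Y y) => (f.1 (c y')).1 x) this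
    · refine congrArg (Quotient.mk _) (GenLoop.ext _ _ fun t => ?_)
      rfl
  · rintro ⟨⟨A⟩, rfl⟩
    have hA : ∀ t ∈ Cube.boundary (Fin n), ∀ x y', A t x y' = y' := fun t ht x y' =>
      congrArg (fun f : C(X, C(Y, Y)) => f x y') (A.2 t ht)
    -- The pointwise action of a family of self-maps of Y; at the null map it gives x ↦ A_t(x)(y),
    -- the image of A_t under ω.
    let g : (Fin n → I) × NullComponent X Y y → C(X, Y) := fun r =>
      ⟨fun x => A r.1 x (r.2.1 x), by fun_prop⟩
    have hg : Continuous g := ContinuousMap.continuous_of_continuous_uncurry _ (by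
      change Continuous fun r : ((Fin n → I) × NullComponent X Y y) × X =>
        A r.1.1 r.2 (r.1.2.1 r.2)
      fun_prop)
    have hg' : ∀ r, (g r).Homotopic (ContinuousMap.const X y) := fun r =>
      (ContinuousMap.homotopic_of_cube (N := Fin n)
        ⟨fun a : (Fin n → I) × X => A a.1 a.2 (r.2.1 a.2), by fun_prop⟩ r.1 (g r) r.2.1
        (fun a => rfl) fun a => (hA 0 Cube.zero_mem_boundary _ _).symm).trans r.2.2
    let Q : C((Fin n → I) × NullComponent X Y y, NullComponent X Y y) :=
      ⟨fun r => ⟨g r, hg' r⟩, hg.subtype_mk hg'⟩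
    obtain ⟨q, hq⟩ := AutOne.exists_genLoop Q fun t ht f =>
      Subtype.ext (ContinuousMap.ext fun x => hA t ht x (f.1 x))
    refine ⟨_, ⟨Quotient.mk _ q, rfl⟩, congrArg (Quotient.mk _) (GenLoop.ext _ _ fun t => ?_)⟩
    exact congrArg Subtype.val (hq t (NullComponent.null X y))

theorem NullComponent.gottliebGroup_mulEquiv [LocallyCompactSpace X] [LocallyCompactSpace Y]
    [PathConnectedSpace Y] (n : ℕ) [NeZero n] (y : Y) :
    Nonempty (gottliebGroup n (NullComponent X Y y) (NullComponent.null X y) ≃*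
      inducedRange n (ContinuousMap.postcompMap X (ContinuousMap.evalAt Y y))
        (h := ContinuousMap.const X (ContinuousMap.id Y)) (y := ContinuousMap.const X y) rfl) :=
  ⟨(Subgroup.equivMapOfInjective _
    (inducedHom n (NullComponent.incl X y) (y := ContinuousMap.const X y) rfl)
    NullComponent.mapOf_incl_injective).trans
    (MulEquiv.subgroupCongr (NullComponent.map_gottliebGroup n y))⟩

/-- Composition of self-maps is a strictly unital multiplication. -/
theorem isUnitalMul_comp [LocallyCompactSpace Y] :
    IsUnitalMul (⟨fun p => p.1.comp p.2, continuous_fst.compCM continuous_snd⟩ :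
      C(C(Y, Y) × C(Y, Y), C(Y, Y)))
      (ContinuousMap.id Y) :=
  ⟨fun _ => rfl, fun _ => rfl⟩

end Gottlieb

/-! ### The index set -/

section Index

namespace SphereChoice

variable {N : ℕ} {k : Fin N → ℕ}

open Classical in
/-- The choice of at most one sphere for every index. -/
noncomputable def toFun (c : SphereChoice k) (i : Fin N) : Option (Fin (k i)) :=
  if h : ∃ j, c.i j = i then some (h.choose_spec ▸ c.m h.choose) else none

theorem toFun_i (c : SphereChoice k) (j : Fin c.r) : c.toFun (c.i j) = some (c.m j) := by
  have h : ∃ j', c.i j' = c.i j := ⟨j, rfl⟩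
  rw [toFun, dif_pos h]
  -- Stated for an arbitrary preimage j', so that injectivity eliminates the transport.
  have key : ∀ (j' : Fin c.r) (h' : c.i j' = c.i j),
      (h' ▸ c.m j' : Fin (k (c.i j))) = c.m j := by
    intro j' h'
    obtain rfl := c.strictMono_i.injective h'
    rfl
  exact congrArg some (key _ h.choose_spec)

theorem toFun_eq_none (c : SphereChoice k) {i : Fin N} (hi : i ∉ Set.range c.i) :
    c.toFun i = none :=
  dif_neg hi

theorem mem_range_iff (c : SphereChoice k) (i : Fin N) :
    i ∈ Set.range c.i ↔ c.toFun i ≠ none := by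
  refine ⟨?_, fun h => by_contra fun hi => h (c.toFun_eq_none hi)⟩
  rintro ⟨j, rfl⟩
  simp [toFun_i]

/-- The support of the family is the range of `i`; its cardinality recovers r, its increasing
enumeration recovers `i`, and the values recover `m`. -/
theorem toFun_injective : Function.Injective (toFun (k := k)) := by
  intro c c' h
  have hr : Set.range c.i = Set.range c'.i := Set.ext fun i => by
    rw [mem_range_iff, mem_range_iff, h]
  have hi := c.toFun_i
  have hi' := c'.toFun_i
  rw [← h] at hi'
  generalize c.toFun = F at hi hi'
  obtain ⟨r, h1, h2, i, hm, m⟩ := c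
  obtain ⟨r', h1', h2', i', hm', m'⟩ := c'
  dsimp only at *
  obtain rfl : r = r' := by
    have := congrArg Set.ncard hr
    rwa [← Set.image_univ, ← Set.image_univ, Set.ncard_image_of_injective _ hm.injective,
      Set.ncard_image_of_injective _ hm'.injective, Set.ncard_univ, Set.ncard_univ, Nat.card_fin,
      Nat.card_fin] at this
  obtain rfl : i = i' := (StrictMono.range_inj hm hm').1 hr
  obtain rfl : m = m' := funext fun j => Option.some_injective _ ((hi j).symm.trans (hi' j))
  rfl

theorem exists_toFun_eq (s : ∀ i, Option (Fin (k i))) (hs : s ≠ fun _ => none) :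
    ∃ c : SphereChoice k, c.toFun = s := by
  let S : Finset (Fin N) := Finset.univ.filter fun i => (s i).isSome
  have hS : ∀ j : Fin S.card, (s (S.orderEmbOfFin rfl j)).isSome := fun j =>
    (Finset.mem_filter.1 (S.orderEmbOfFin_mem rfl j)).2
  have hne : S.Nonempty := by
    obtain ⟨i, hi⟩ := Function.ne_iff.1 hs
    exact ⟨i, Finset.mem_filter.2 ⟨Finset.mem_univ _, Option.isSome_iff_ne_none.2 hi⟩⟩
  let c : SphereChoice k := ⟨S.card, hne.card_pos, (Finset.card_le_univ S).trans (by simp),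
    S.orderEmbOfFin rfl, (S.orderEmbOfFin rfl).strictMono, fun j => (s _).get (hS j)⟩
  refine ⟨c, funext fun i => ?_⟩
  by_cases hi : i ∈ Set.range c.i
  · obtain ⟨j, rfl⟩ := hi
    rw [toFun_i]
    exact Option.some_get (hS j)
  · rw [toFun_eq_none c hi]
    have : i ∉ S := by
      rwa [show Set.range c.i = S from Finset.range_orderEmbOfFin S rfl] at hi
    by_contra h
    exact this (Finset.mem_filter.2 ⟨Finset.mem_univ _, Option.isSome_iff_ne_none.2 (Ne.symm h)⟩)

theorem sum_toFun (c : SphereChoice k) (d : ∀ i, Fin (k i) → ℕ) :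
    ∑ i, (c.toFun i).elim 0 (d i) = ∑ j, d (c.i j) (c.m j) := by
  refine (Fintype.sum_of_injective c.i c.strictMono_i.injective _ _ (fun i hi => ?_)
    fun j => ?_).symm
  · rw [toFun_eq_none c hi]
    rfl
  · rw [toFun_i]
    rfl

/-- Families of choices of at most one sphere for every index. -/
noncomputable def optionEquiv (k : Fin N → ℕ) :
    Option (SphereChoice k) ≃ ∀ i, Option (Fin (k i)) :=
  Equiv.ofBijective (fun o => o.elim (fun _ => none) toFun) (by
    -- Since r ≥ 1, no `SphereChoice` gives the empty family, which is left for `none`.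
    have hne : ∀ c : SphereChoice k, c.toFun ≠ fun _ => none := fun c h => by
      have := c.toFun_i ⟨0, c.one_le_r⟩
      rw [h] at this
      cases this
    constructor
    · rintro (_ | c) (_ | c') h
      · rfl
      · exact absurd h.symm (hne c')
      · exact absurd h (hne c)
      · exact congrArg some (toFun_injective h)
    · intro s
      by_cases hs : s = fun _ => none
      · exact ⟨none, hs.symm⟩
      · obtain ⟨c, hc⟩ := exists_toFun_eq s hs
        exact ⟨some c, hc⟩)

theorem optionEquiv_none (i : Fin N) : optionEquiv k none i = none := rfl

end SphereChoice

end Index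

/-! ### The decomposition theorem -/

theorem mainTheorem5 {N : ℕ} {X : Fin N → Type*} [∀ i, TopologicalSpace (X i)]
    [∀ i, T2Space (X i)] [∀ i, LocallyCompactSpace (X i)] [∀ i, ConnectedSpace (X i)]
    (x : ∀ i, X i) (hx : ∀ i, WellPointed (X i) (x i))
    {Y : Type*} [TopologicalSpace Y] [T2Space Y] [LocallyCompactSpace Y] [PathConnectedSpace Y]
    (y : Y) (hy : WellPointed Y y)
    (k : Fin N → ℕ) (d : ∀ i, Fin (k i) → ℕ)
    (hX : ∀ i, BasedHomotopyEquivalent (ReducedSuspension.base (x i))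
      (Wedge.base fun j : Fin (k i) => Sphere.base (d i j + 1)))
    (n : ℕ) [NeZero n] :
    Nonempty (gottliebGroup n (NullComponent (∀ i, X i) Y y) (NullComponent.null (∀ i, X i) y) ≃*
      gottliebGroup n Y y ×
        ∀ s : SphereChoice k, gottliebGroup (n + ∑ j, d (s.i j) (s.m j)) Y y) := by
  obtain ⟨e₁⟩ := NullComponent.gottliebGroup_mulEquiv (X := ∀ i, X i) n y
  obtain ⟨e₂⟩ := inducedRange_postcompMap_pi (y := y) (isUnitalMul_comp (Y := Y))
    (ContinuousMap.evalAt Y y) rfl x hx k d hX n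
  -- The index `none` has total degree n and yields the separate summand G_n(Y).
  obtain ⟨e₃⟩ := nonempty_prodPi_mulEquiv_option
    (A := gottliebGroup n Y y)
    (B := fun s : SphereChoice k => gottliebGroup (n + ∑ j, d (s.i j) (s.m j)) Y y)
    (G := fun o => inducedRange (n + ∑ i, (SphereChoice.optionEquiv k o i).elim 0 (d i))
      (ContinuousMap.evalAt Y y) (h := ContinuousMap.id Y) (y := y) rfl)
    (by
      rw [gottliebGroup_eq_inducedRange]
      exact inducedRange_mulEquiv_of_eq _ _ (by simp [SphereChoice.optionEquiv_none]))
    (fun s => by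
      rw [gottliebGroup_eq_inducedRange]
      exact inducedRange_mulEquiv_of_eq _ _ (congrArg _ (s.sum_toFun d).symm))
  obtain ⟨e₄⟩ := nonempty_piMulEquiv
    (G' := fun s : ∀ i, Option (Fin (k i)) => inducedRange (n + ∑ i, (s i).elim 0 (d i))
      (ContinuousMap.evalAt Y y) (h := ContinuousMap.id Y) (y := y) rfl)
    (SphereChoice.optionEquiv k) fun o => ⟨MulEquiv.refl _⟩
  exact ⟨e₁.trans (e₂.trans (e₄.symm.trans e₃.symm))⟩
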